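/- Let $\mathcal R(s)$ be Riemann's auxiliary function, \[\mathcal R(s)=\int_{0\swarrow1}\frac{x^{-s}e^{\pi i x^2}}{e^{\pi i x}-e^{-\pi i x}}\,dx ,\] where the path of integration is a straight line of direction $e^{\pi i/4}$ crossing the real axis between $0$ and $1$, traversed from upper right to lower left, and $x^{-s}$ has its principal value. The function $\mathcal R$ is entire. Let $\omega\colon\mathbf R\to\mathbf R$ be the unique real analytic function with $\omega(0)=-\arg\mathcal R(\tfrac12)$ (principal argument) for which there is a real analytic $g\colon\mathbf R\to\mathbf R$ with \[\mathcal R(\tfrac12+it)=e^{-i\omega(t)}g(t)\qquad(t\in\mathbf R).\] For real $T$ let $N_r(T)$ be the number of zeros $\varrho=\beta+i\gamma$ of $\mathcal R(s)$ with $0<\gamma\le T$ and $\beta\ge\tfrac12$, counted with multiplicity, where a zero with $\beta=\tfrac12$ or with $\gamma=T$ is counted with a factor one half. For each $T$ there are only finitely many such zeros, and such a function $\omega$ exists and is unique. Then, as $T\to+\infty$, \[\omega(T)=2\pi N_r(T)+O(\log T).\] -/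

import Mathlib

open Filter Asymptotics

noncomputable section

namespace RiemannAuxiliary

/-- The straight line of direction `e^{πi/4}` that crosses the real axis at `1/2`,
hence between `0` and `1`. As `u` decreases from `+∞` to `-∞` it is run through from the
upper right to the lower left. -/
def path (u : ℝ) : ℂ :=
  1 / 2 + (u : ℂ) * Complex.exp (Real.pi * Complex.I / 4)

/-- The integrand `x^{-s} e^{πi x²} / (e^{πi x} - e^{-πi x})`, with the principal branch of the
power (the line `path` does not meet the half-line `(-∞, 0]`). -/
def integrand (s x : ℂ) : ℂ :=
  x ^ (-s) * Complex.exp (Real.pi * Complex.I * x ^ 2) /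
    (Complex.exp (Real.pi * Complex.I * x) - Complex.exp (-(Real.pi * Complex.I * x)))

/-- Riemann's auxiliary function
`R(s) = ∫_{0↙1} x^{-s} e^{πi x²} / (e^{πi x} - e^{-πi x}) dx`.
The minus sign is there because the line is run through downwards. -/
def auxR (s : ℂ) : ℂ :=
  -∫ u : ℝ, integrand s (path u) * Complex.exp (Real.pi * Complex.I / 4)

/-- `ω` is the real analytic function, normalised by `ω(0) = -arg R(1/2)`, such that
`R(1/2 + it) = e^{-iω(t)} g(t)` for some real-valued real analytic `g`. -/
def IsOmega (ω : ℝ → ℝ) : Prop :=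
  AnalyticOnNhd ℝ ω Set.univ ∧
  ω 0 = -Complex.arg (auxR (1 / 2)) ∧
  ∃ g : ℝ → ℝ, AnalyticOnNhd ℝ g Set.univ ∧
    ∀ t : ℝ, auxR (1 / 2 + Complex.I * (t : ℂ)) = Complex.exp (-(Complex.I * (ω t : ℂ))) * (g t : ℂ)

/-- The zeros `β + iγ` of `R` with `0 < γ ≤ T` and `β ≥ 1/2`. -/
def rightZeros (T : ℝ) : Set ℂ :=
  {ρ | auxR ρ = 0 ∧ 0 < ρ.im ∧ ρ.im ≤ T ∧ 1 / 2 ≤ ρ.re}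

/-- Zeros on the critical line or at height exactly `T` count one half. -/
def weight (T : ℝ) (ρ : ℂ) : ℝ :=
  open Classical in if ρ.re = 1 / 2 ∨ ρ.im = T then 1 / 2 else 1

/-- `N_r(T)`: the weighted number of elements of `rightZeros T`, with multiplicity. -/
def Nr (T : ℝ) : ℝ :=
  ∑ᶠ ρ ∈ rightZeros T, weight T ρ * (analyticOrderNatAt auxR ρ : ℝ)

end RiemannAuxiliary

end

namespace RiemannAuxiliary

/-! Where $\mathcal R\ne0$ on the critical line, differentiating $\mathcal R=e^{-i\omega}g$ gives
$\mathcal R'/\mathcal R=-\omega'-ig'/g$, so $\omega(T)=\omega(0)-\int_0^T\mathrm{Re}(\mathcal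
R'/\mathcal R)(\tfrac12+it)\,dt$ (`IsOmega.eq_sub_ver`). This formula gives uniqueness, and read as
a definition it gives existence (`isOmega_phase`). A zero $\varrho$ on the line is harmless, because
$\mathrm{Re}\,(z-\varrho)^{-1}$ vanishes on the vertical line through $\varrho$.

The integral is the left edge of the argument principle for $[\tfrac12,b]\times[0,T]$. In
`rect_logDeriv_eq` each zero is weighted by the angle under which it sees the rectangle, so zeros on
edges need no indentation. The angles agree with $2\pi$ times the weights in $N_r$ except for zeros
on the real axis, a contribution bounded independently of $T$, and a possible zero at $\tfrac12+iT$
(`abs_sum_angle_sub_Nr_le`). The lower edge does not depend on $T$. The right edge is bounded, since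
$|\mathcal R-1|\le\tfrac12$ far to the right (`exists_norm_auxR_sub_one_le`).

The upper edge and the multiplicity at $\tfrac12+iT$ are $O(\log T)$ by `exists_top_bound`: in a
disc of fixed radius about $b+iT$, polynomial growth of $\mathcal R$ bounds both the number of zeros
and the zero-free part of $\mathcal R'/\mathcal R$ (`exists_local_decomposition`).

Both analytic facts about $\mathcal R$ come from moving the line of integration to $n+\tfrac12$ near
the saddle point $\sqrt{t/2\pi}$. The poles crossed contribute $\sum_{k\le n}k^{-s}$
(`auxR_eq_sum_sub_lineIntegral`), and the remaining integral has a Gaussian majorant uniform in $t$.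
Finally $\mathrm{Re}\,\mathcal R(\tfrac12)<0$ (`re_auxR_half_neg`) shows that $\mathcal R$ is not
identically zero and starts the phase at a regular point. -/

/-! ### Geometry of the lines of integration and the saddle-point inequality -/

/-- The line of direction `e^{πi/4}` through the real point `c`. -/
noncomputable def line (c u : ℝ) : ℂ := (c : ℂ) + (u : ℂ) * Complex.exp (Real.pi * Complex.I / 4)

/-- Half the square root of two, the cosine of `π/4`. -/
noncomputable def rt : ℝ := √2 / 2

lemma rt_sq : rt ^ 2 = 1 / 2 := by
  have := Real.sq_sqrt (show (0 : ℝ) ≤ 2 by norm_num)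
  unfold rt; nlinarith

lemma rt_pos : 0 < rt := by unfold rt; positivity

lemma rt_lt_one : rt < 1 := by nlinarith [rt_sq, rt_pos]

lemma path_eq_line (u : ℝ) : path u = line (1 / 2) u := by
  simp [path, line]

lemma exp_quarter : Complex.exp (Real.pi * Complex.I / 4) = (rt : ℂ) * (1 + Complex.I) := by
  have h : (Real.pi * Complex.I / 4 : ℂ) = ((Real.pi / 4 : ℝ) : ℂ) * Complex.I := by push_cast; ring
  rw [h, Complex.exp_mul_I, ← Complex.ofReal_cos, ← Complex.ofReal_sin, Real.cos_pi_div_four,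
    Real.sin_pi_div_four, rt]
  push_cast; ring

lemma line_eq (c u : ℝ) : line c u = ((c + rt * u : ℝ) : ℂ) + ((rt * u : ℝ) : ℂ) * Complex.I := by
  rw [line, exp_quarter]; push_cast; ring

@[simp] lemma line_re (c u : ℝ) : (line c u).re = c + rt * u := by rw [line_eq]; simp

@[simp] lemma line_im (c u : ℝ) : (line c u).im = rt * u := by rw [line_eq]; simp

lemma line_zero (c : ℝ) : line c 0 = c := by simp [line]

lemma normSq_line (c u : ℝ) : ‖line c u‖ ^ 2 = (c + rt * u) ^ 2 + (rt * u) ^ 2 := by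
  rw [← Complex.normSq_eq_norm_sq, Complex.normSq_apply, line_re, line_im]; ring

lemma mul_rt_le_norm_line (c u : ℝ) : c * rt ≤ ‖line c u‖ := by
  refine le_of_sq_le_sq ?_ (norm_nonneg _)
  rw [normSq_line, mul_pow, rt_sq]
  nlinarith [sq_nonneg (c + 2 * (rt * u))]

lemma norm_line_le {c : ℝ} (hc : 0 ≤ c) (u : ℝ) : ‖line c u‖ ≤ c + |u| := by
  unfold line
  refine (norm_add_le _ _).trans ?_
  have h : (Real.pi * Complex.I / 4 : ℂ) = ((Real.pi / 4 : ℝ) : ℂ) * Complex.I := by push_cast; ring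
  rw [norm_mul, h, Complex.norm_exp_ofReal_mul_I]
  simp [abs_of_nonneg hc]

lemma line_mem_slitPlane {c : ℝ} (hc : 0 < c) (u : ℝ) : line c u ∈ Complex.slitPlane := by
  rw [Complex.mem_slitPlane_iff, line_re, line_im]
  by_cases h : rt * u = 0
  · left; rw [h]; simpa
  · exact Or.inr h

lemma line_ne_zero {c : ℝ} (hc : 0 < c) (u : ℝ) : line c u ≠ 0 :=
  Complex.slitPlane_ne_zero (line_mem_slitPlane hc u)

lemma hasDerivAt_line (c u : ℝ) :
    HasDerivAt (line c) (Complex.exp (Real.pi * Complex.I / 4)) u := by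
  have h : HasDerivAt (fun u : ℝ => (u : ℂ)) 1 u := Complex.ofRealCLM.hasDerivAt
  have := (h.mul_const (Complex.exp (Real.pi * Complex.I / 4))).const_add (c : ℂ)
  rw [one_mul] at this
  exact this

lemma continuous_line (c : ℝ) : Continuous (line c) := by unfold line; fun_prop

lemma hasDerivAt_arg_line {c : ℝ} (hc : 0 < c) (u : ℝ) :
    HasDerivAt (fun u => (line c u).arg) (c * rt / ((c + rt * u) ^ 2 + (rt * u) ^ 2)) u := by
  have h := (hasDerivAt_line c u).clog_real (line_mem_slitPlane hc u)
  have h2 := (Complex.imCLM.hasFDerivAt.comp_hasDerivAt u h)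
  have e : ((rt : ℂ) * (1 + Complex.I) / line c u).im
      = c * rt / ((c + rt * u) ^ 2 + (rt * u) ^ 2) := by
    rw [Complex.div_im, ← normSq_line, line_re, line_im, Complex.normSq_eq_norm_sq]
    simp
    ring
  simp only [Function.comp_def, Complex.imCLM_apply, Complex.log_im, exp_quarter, e] at h2
  exact h2

lemma arg_line_zero {c : ℝ} (hc : 0 < c) : (line c 0).arg = 0 := by
  rw [line_zero]; exact Complex.arg_ofReal_of_nonneg hc.le

lemma le_of_mul_deriv_nonpos {f f' : ℝ → ℝ} (hf : ∀ x, HasDerivAt f (f' x) x)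
    (h : ∀ x, x * f' x ≤ 0) (x : ℝ) : f x ≤ f 0 := by
  have hd : ∀ y, deriv f y = f' y := fun y => (hf y).deriv
  have hc : Continuous f := continuous_iff_continuousAt.2 fun y => (hf y).continuousAt
  rcases le_total 0 x with hx | hx
  · refine antitoneOn_of_deriv_nonpos (convex_Ici 0) hc.continuousOn
      (fun y _ => (hf y).differentiableAt.differentiableWithinAt) (fun y hy => ?_)
      Set.self_mem_Ici hx hx
    rw [interior_Ici, Set.mem_Ioi] at hy
    rw [hd]; nlinarith [h y]
  · refine monotoneOn_of_deriv_nonneg (convex_Iic 0) hc.continuousOn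
      (fun y _ => (hf y).differentiableAt.differentiableWithinAt) (fun y hy => ?_)
      hx Set.self_mem_Iic hx
    rw [interior_Iic, Set.mem_Iio] at hy
    rw [hd]; nlinarith [h y]

lemma line_den_pos {c : ℝ} (hc : 0 < c) (q : ℝ) : 0 < (c + q) ^ 2 + q ^ 2 := by
  nlinarith [sq_nonneg (c + 2 * q), mul_pos hc hc]

/-- For $t=2\pi c^2$ the factor $e^{t\arg x}|e^{\pi ix^2}|$ is $\exp 2\pi(c^2\arg
x-\mathrm{Re}\,x\,\mathrm{Im}\,x)$, with saddle point at $x=c$. After adding half the square of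
$q=\mathrm{Im}\,x$, the derivative still has the sign of $-u$, because $3c^2+4cq+2q^2\ge0$. The
maximum is therefore the value $0$ at $u=0$. -/
lemma arg_line_saddle {c : ℝ} (hc : 0 < c) (u : ℝ) :
    c ^ 2 * (line c u).arg - (rt * u) * (c + rt * u) ≤ -(rt * u) ^ 2 / 2 := by
  have key := le_of_mul_deriv_nonpos
    (f := fun u => c ^ 2 * (line c u).arg - (rt * u) * (c + rt * u) + (rt * u) ^ 2 / 2)
    (f' := fun u => rt * (-(rt * u) * (3 * c ^ 2 + 4 * c * (rt * u) + 2 * (rt * u) ^ 2)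
      / ((c + rt * u) ^ 2 + (rt * u) ^ 2))) ?_ ?_ u
  · simp only [arg_line_zero hc] at key
    linarith
  · intro x
    have h1 := (hasDerivAt_arg_line hc x).const_mul (c ^ 2)
    have h2 : HasDerivAt (fun u => rt * u) rt x := by simpa using (hasDerivAt_id x).const_mul rt
    have h3 := h2.fun_mul (h2.const_add c)
    have h4 := (h2.fun_pow 2).div_const 2
    have h5 := (h1.fun_sub h3).fun_add h4
    refine h5.congr_deriv ?_
    have := (line_den_pos hc (rt * x)).ne'
    generalize hD : (c + rt * x) ^ 2 + (rt * x) ^ 2 = D at this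
    field_simp
    rw [← hD]
    push_cast
    ring
  · intro x
    have hp := line_den_pos hc (rt * x)
    have : x * (rt * (-(rt * x) * (3 * c ^ 2 + 4 * c * (rt * x) + 2 * (rt * x) ^ 2)
      / ((c + rt * x) ^ 2 + (rt * x) ^ 2))) = -((rt * x) ^ 2 * (3 * c ^ 2 + 4 * c * (rt * x)
        + 2 * (rt * x) ^ 2) / ((c + rt * x) ^ 2 + (rt * x) ^ 2)) := by ring
    rw [this, neg_nonpos]
    have h3 : 0 ≤ 3 * c ^ 2 + 4 * c * (rt * x) + 2 * (rt * x) ^ 2 := by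
      nlinarith [sq_nonneg (c + rt * x), sq_nonneg c]
    positivity

/-- On the line $|x|^2\ge c^2/2$, so the derivative of the argument is at most $2\cdot$`rt`$/c$. -/
lemma abs_arg_line_le {c : ℝ} (hc : 0 < c) (u : ℝ) : |(line c u).arg| ≤ 2 / c * |rt * u| := by
  have key := convex_univ.norm_image_sub_le_of_norm_hasDerivWithin_le
    (f := fun u => (line c u).arg) (C := 2 / c * rt) (x := 0) (y := u)
    (fun x _ => (hasDerivAt_arg_line hc x).hasDerivWithinAt) (fun x _ => ?_)
    (Set.mem_univ _) (Set.mem_univ _)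
  · simp only [arg_line_zero hc, sub_zero, Real.norm_eq_abs] at key
    rw [abs_mul, abs_of_pos rt_pos, ← mul_assoc]; exact key
  · have hp := line_den_pos hc (rt * x)
    have := rt_pos
    rw [Real.norm_of_nonneg (by positivity), div_le_iff₀ hp, mul_comm c rt, mul_comm (2 / c) rt,
      mul_assoc]
    refine mul_le_mul_of_nonneg_left ?_ this.le
    rw [div_mul_eq_mul_div, le_div_iff₀ hc]
    nlinarith [sq_nonneg (c + 2 * (rt * x))]

/-! ### Gaussian bounds for the integrand on the lines through half-integers -/

lemma normSq_exp_sub_exp_neg (w : ℂ) : ‖Complex.exp w - Complex.exp (-w)‖ ^ 2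
    = 2 * Real.cosh (2 * w.re) - 2 * Real.cos (2 * w.im) := by
  rw [← Complex.normSq_eq_norm_sq, Complex.normSq_apply]
  simp only [Complex.sub_re, Complex.sub_im, Complex.exp_re, Complex.exp_im, Complex.neg_re,
    Complex.neg_im, Real.cos_neg, Real.sin_neg, Real.cosh_eq, Real.cos_two_mul]
  have h1 : Real.exp (2 * w.re) = Real.exp w.re ^ 2 := by rw [← Real.exp_nat_mul]; norm_num
  have h2 : Real.exp (-(2 * w.re)) = Real.exp (-w.re) ^ 2 := by
    rw [← Real.exp_nat_mul]; congr 1; push_cast; ring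
  have h3 : Real.exp w.re * Real.exp (-w.re) = 1 := by rw [← Real.exp_add]; simp
  have h4 := Real.sin_sq_add_cos_sq w.im
  rw [h1, h2]
  linear_combination (Real.exp w.re ^ 2 + Real.exp (-w.re) ^ 2 + 2 * Real.exp w.re * Real.exp (-w.re)) * h4 + (2 - 4 * Real.cos w.im ^ 2) * h3

lemma one_add_sq_div_two_le_cosh (x : ℝ) : 1 + x ^ 2 / 2 ≤ Real.cosh x := by
  have h := Real.cosh_two_mul (x / 2)
  rw [mul_div_cancel₀ _ (two_ne_zero)] at h
  rw [h, Real.cosh_sq']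
  have hs : (x / 2) ^ 2 ≤ Real.sinh (x / 2) ^ 2 := by
    rw [sq_le_sq, Real.abs_sinh]; exact Real.self_le_sinh_iff.2 (abs_nonneg _)
  nlinarith

/-- In direction $e^{\pi i/4}$ the real and imaginary displacements are equal. At a half-integer
crossing the squared modulus is thus $2\cosh y+2\cos y$ with the same $y$, and the quadratic terms
of $\cosh y\ge1+y^2/2$ and $\cos y\ge1-y^2/2$ cancel. -/
lemma two_le_norm_den (n : ℕ) (u : ℝ) :
    2 ≤ ‖Complex.exp (Real.pi * Complex.I * line (n + 1 / 2) u)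
      - Complex.exp (-(Real.pi * Complex.I * line (n + 1 / 2) u))‖ := by
  refine le_of_sq_le_sq ?_ (norm_nonneg _)
  rw [normSq_exp_sub_exp_neg]
  have h1 : (Real.pi * Complex.I * line (n + 1 / 2) u).re = -(Real.pi * (rt * u)) := by simp
  have h2 : (Real.pi * Complex.I * line (n + 1 / 2) u).im = Real.pi * (n + 1 / 2 + rt * u) := by
    simp
  rw [h1, h2]
  have h3 : 2 * (Real.pi * (n + 1 / 2 + rt * u))
      = 2 * (Real.pi * (rt * u)) + Real.pi + n * (2 * Real.pi) := by ring
  rw [h3, Real.cos_add_nat_mul_two_pi, Real.cos_add_pi, mul_neg, Real.cosh_neg]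
  have h4 := one_add_sq_div_two_le_cosh (2 * (Real.pi * (rt * u)))
  have h5 := Real.one_sub_sq_div_two_le_cos (x := 2 * (Real.pi * (rt * u)))
  linarith

lemma norm_cpow_neg {x : ℂ} (hx : x ≠ 0) (s : ℂ) :
    ‖x ^ (-s)‖ = ‖x‖ ^ (-s.re) * Real.exp (s.im * x.arg) := by
  rw [Complex.norm_cpow_of_ne_zero hx, Complex.neg_re, Complex.neg_im, div_eq_mul_inv,
    ← Real.exp_neg]
  congr 2; ring

lemma norm_exp_sq (x : ℂ) : ‖Complex.exp (Real.pi * Complex.I * x ^ 2)‖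
    = Real.exp (-(2 * Real.pi * (x.re * x.im))) := by
  rw [Complex.norm_exp]; congr 1
  simp [pow_two]; ring

/-- Split $t=2\pi c^2+(t-2\pi c^2)$. The first part gives the Gaussian by `arg_line_saddle`; the
mismatch costs only a factor exponential in $|u|$, because the argument is Lipschitz in $u$ with
constant $O(1/c)$. -/
lemma norm_integrand_le (n : ℕ) (s : ℂ) (u : ℝ) :
    ‖integrand s (line (n + 1 / 2) u)‖ ≤ ‖line (n + 1 / 2) u‖ ^ (-s.re) *
      Real.exp (-Real.pi / 2 * u ^ 2 +
        |s.im - 2 * Real.pi * ((n : ℝ) + 1 / 2) ^ 2| * (2 / ((n : ℝ) + 1 / 2) * |u|)) := by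
  set c : ℝ := (n : ℝ) + 1 / 2 with hc'
  have hc : 0 < c := by positivity
  rw [integrand, norm_div, norm_mul, norm_cpow_neg (line_ne_zero hc u), norm_exp_sq]
  refine (div_le_of_le_mul₀ (norm_nonneg _) (by positivity)
    (le_mul_of_one_le_right (by positivity) (by linarith [two_le_norm_den n u]))).trans ?_
  rw [mul_assoc, ← Real.exp_add]
  refine mul_le_mul_of_nonneg_left (Real.exp_le_exp.2 ?_) (by positivity)
  rw [line_re, line_im]
  have h1 := arg_line_saddle hc u
  have h2 := abs_arg_line_le hc u
  have h3 : (s.im - 2 * Real.pi * c ^ 2) * (line c u).arg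
      ≤ |s.im - 2 * Real.pi * c ^ 2| * (2 / c * |u|) := by
    refine (le_abs_self _).trans ?_
    rw [abs_mul]
    refine mul_le_mul_of_nonneg_left (h2.trans ?_) (abs_nonneg _)
    refine mul_le_mul_of_nonneg_left ?_ (by positivity)
    rw [abs_mul, abs_of_pos rt_pos]
    exact mul_le_of_le_one_left (abs_nonneg _) rt_lt_one.le
  have h4 : (rt * u) ^ 2 = u ^ 2 / 2 := by rw [mul_pow, rt_sq]; ring
  rw [h4] at h1
  nlinarith [Real.pi_pos, mul_le_mul_of_nonneg_left h1 (show 0 ≤ 2 * Real.pi by positivity)]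

lemma integrable_exp_neg_sq_add {b : ℝ} (hb : 0 < b) (A B : ℝ) :
    MeasureTheory.Integrable fun u : ℝ => Real.exp (-b * u ^ 2 + A * |u| + B) := by
  refine ((integrable_exp_neg_mul_sq (half_pos hb)).const_mul
    (Real.exp (A ^ 2 / (2 * b) + B))).mono' (by fun_prop) (.of_forall fun u => ?_)
  rw [Real.norm_of_nonneg (Real.exp_pos _).le, ← Real.exp_add]
  refine Real.exp_le_exp.2 ?_
  have h1 : A * |u| ≤ A ^ 2 / (2 * b) + b / 2 * u ^ 2 := by
    have h : A ^ 2 / (2 * b) + b / 2 * u ^ 2 - A * |u| = (A - b * |u|) ^ 2 / (2 * b) := by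
      rw [← sq_abs u]; field_simp; ring
    have h0 : 0 ≤ (A - b * |u|) ^ 2 / (2 * b) := by positivity
    linarith
  linarith

lemma den_ne_zero (n : ℕ) (u : ℝ) : Complex.exp (Real.pi * Complex.I * line (n + 1 / 2) u)
      - Complex.exp (-(Real.pi * Complex.I * line (n + 1 / 2) u)) ≠ 0 := by
  rw [← norm_ne_zero_iff]
  exact (two_pos.trans_le (two_le_norm_den n u)).ne'

lemma half_line_pos (n : ℕ) : (0 : ℝ) < (n : ℝ) + 1 / 2 := by positivity

lemma continuous_integrand_line (n : ℕ) (s : ℂ) :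
    Continuous fun u => integrand s (line (n + 1 / 2) u) := by
  unfold integrand
  have h := continuous_line ((n : ℝ) + 1 / 2)
  refine Continuous.div ?_ (by fun_prop) (den_ne_zero n)
  refine Continuous.mul ?_ (by fun_prop)
  exact h.cpow continuous_const fun u => line_mem_slitPlane (half_line_pos n) u

lemma abs_log_norm_line_le {c : ℝ} (hc : 1 / 2 ≤ c) (u : ℝ) :
    |Real.log ‖line c u‖| ≤ c + |u| + 2 := by
  have h0 := mul_rt_le_norm_line c u
  have h1 := norm_line_le (by linarith) u (c := c)
  have hr : 2 / 3 < rt := by nlinarith [rt_sq, rt_pos]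
  have hpos : 1 / 3 ≤ ‖line c u‖ := by nlinarith
  have hu := abs_nonneg u
  rw [abs_le]
  constructor
  · have := Real.one_sub_inv_le_log_of_pos (show 0 < ‖line c u‖ by linarith)
    have h3 : ‖line c u‖⁻¹ ≤ 3 := by
      rw [inv_le_comm₀ (by linarith) (by norm_num)]; linarith
    linarith
  · have := Real.log_le_sub_one_of_pos (show 0 < ‖line c u‖ by linarith)
    linarith

lemma norm_log_line_le {c : ℝ} (hc : 1 / 2 ≤ c) (u : ℝ) :
    ‖Complex.log (line c u)‖ ≤ c + |u| + 6 := by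
  refine (Complex.norm_le_abs_re_add_abs_im _).trans ?_
  rw [Complex.log_re, Complex.log_im]
  have := abs_log_norm_line_le hc u
  have := Complex.abs_arg_le_pi (line c u)
  linarith [Real.pi_lt_four]

lemma norm_line_rpow_le {c : ℝ} (hc : 1 / 2 ≤ c) (u a : ℝ) :
    ‖line c u‖ ^ a ≤ Real.exp (|a| * (c + |u| + 2)) := by
  rw [Real.rpow_def_of_pos (norm_pos_iff.2 (line_ne_zero (by linarith) u))]
  refine Real.exp_le_exp.2 ((le_abs_self _).trans ?_)
  rw [abs_mul, mul_comm]
  exact mul_le_mul_of_nonneg_left (abs_log_norm_line_le hc u) (abs_nonneg _)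

lemma norm_integrand_le_exp (n : ℕ) (s : ℂ) (u : ℝ) {a K : ℝ} (ha : |s.re| ≤ a)
    (hK : |s.im - 2 * Real.pi * ((n : ℝ) + 1 / 2) ^ 2| ≤ K) :
    ‖integrand s (line (n + 1 / 2) u)‖ ≤
      Real.exp (-(Real.pi / 2) * u ^ 2 + (a + K * (2 / ((n : ℝ) + 1 / 2))) * |u|
        + a * ((n : ℝ) + 1 / 2 + 2)) := by
  refine (norm_integrand_le n s u).trans ?_
  have hc : (1 / 2 : ℝ) ≤ (n : ℝ) + 1 / 2 := by simp
  have h2 := norm_line_rpow_le hc u (-s.re)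
  rw [abs_neg] at h2
  refine (mul_le_mul_of_nonneg_right h2 (Real.exp_pos _).le).trans ?_
  rw [← Real.exp_add]
  refine Real.exp_le_exp.2 ?_
  have h3 : |s.re| * ((n : ℝ) + 1 / 2 + |u| + 2) ≤ a * ((n : ℝ) + 1 / 2 + |u| + 2) := by gcongr
  have h4 := mul_le_mul_of_nonneg_right hK
    (show 0 ≤ 2 / ((n : ℝ) + 1 / 2) * |u| by positivity)
  linarith

lemma integrable_integrand_line (n : ℕ) (s : ℂ) :
    MeasureTheory.Integrable fun u => integrand s (line (n + 1 / 2) u) := by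
  refine (integrable_exp_neg_sq_add (by positivity : (0 : ℝ) < Real.pi / 2) _ _).mono'
    (continuous_integrand_line n s).aestronglyMeasurable
    (.of_forall fun u => norm_integrand_le_exp n s u le_rfl le_rfl)

/-! ### The line integrals are entire functions -/

/-- The integral of the integrand of `auxR` upwards along the line through `n + 1/2`. -/
noncomputable def lineIntegral (n : ℕ) (s : ℂ) : ℂ :=
  ∫ u : ℝ, integrand s (line (n + 1 / 2) u) * Complex.exp (Real.pi * Complex.I / 4)

lemma auxR_eq_neg_lineIntegral (s : ℂ) : auxR s = -lineIntegral 0 s := by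
  simp [auxR, lineIntegral, path_eq_line]

lemma hasDerivAt_integrand {x : ℂ} (hx : x ≠ 0) (s : ℂ) :
    HasDerivAt (fun s => integrand s x) (-Complex.log x * integrand s x) s := by
  have h1 : HasDerivAt (fun s : ℂ => x ^ (-s)) (x ^ (-s) * Complex.log x * -1) s :=
    ((hasDerivAt_id s).neg).const_cpow (Or.inl hx)
  have h2 := (h1.mul_const (Complex.exp (Real.pi * Complex.I * x ^ 2))).div_const
    (Complex.exp (Real.pi * Complex.I * x) - Complex.exp (-(Real.pi * Complex.I * x)))
  refine h2.congr_deriv ?_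
  unfold integrand; ring

lemma differentiable_lineIntegral (n : ℕ) : Differentiable ℂ (lineIntegral n) := by
  intro s₀
  set c : ℝ := (n : ℝ) + 1 / 2 with hc'
  have hc : (1 / 2 : ℝ) ≤ c := by simp [hc']
  set a := |s₀.re| + 1
  set K := |s₀.im - 2 * Real.pi * c ^ 2| + 1
  have he : ‖Complex.exp (Real.pi * Complex.I / 4)‖ = 1 := by
    have h : (Real.pi * Complex.I / 4 : ℂ) = ((Real.pi / 4 : ℝ) : ℂ) * Complex.I := by
      push_cast; ring
    rw [h, Complex.norm_exp_ofReal_mul_I]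
  have hmeas : ∀ s, Continuous fun u => integrand s (line (n + 1 / 2) u) *
      Complex.exp (Real.pi * Complex.I / 4) := fun s => by
    have := continuous_integrand_line n s
    fun_prop
  have hcl : Continuous fun u => -Complex.log (line c u) :=
    ((continuous_line c).clog fun u => line_mem_slitPlane (by linarith) u).neg
  have key := hasDerivAt_integral_of_dominated_loc_of_deriv_le (μ := MeasureTheory.volume)
    (F := fun s u => integrand s (line (n + 1 / 2) u) * Complex.exp (Real.pi * Complex.I / 4))
    (F' := fun s u => (-Complex.log (line (n + 1 / 2) u) * integrand s (line (n + 1 / 2) u)) *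
      Complex.exp (Real.pi * Complex.I / 4)) (x₀ := s₀) (s := Metric.ball s₀ 1)
    (bound := fun u => Real.exp (-(Real.pi / 2) * u ^ 2 + (a + K * (2 / c) + 1) * |u|
        + (a * (c + 2) + c + 6)))
    (Metric.ball_mem_nhds _ one_pos)
    (.of_forall fun s => (hmeas s).aestronglyMeasurable)
    ((integrable_integrand_line n s₀).mul_const _)
    ((hcl.mul (continuous_integrand_line n s₀)).mul_const _).aestronglyMeasurable
    (.of_forall fun u s hs => ?_)
    (integrable_exp_neg_sq_add (by positivity) _ _)
    (.of_forall fun u s _ =>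
      (hasDerivAt_integrand (line_ne_zero (half_line_pos n) u) s).mul_const _)
  · exact key.2.differentiableAt
  · rw [norm_mul, norm_mul, he, mul_one, norm_neg]
    rw [Metric.mem_ball, dist_eq_norm] at hs
    have h1 : |s.re| ≤ a := by
      have h := (Complex.abs_re_le_norm (s - s₀)).trans hs.le
      rw [Complex.sub_re] at h
      have := abs_sub_abs_le_abs_sub s.re s₀.re
      simp only [a]; linarith
    have h2 : |s.im - 2 * Real.pi * c ^ 2| ≤ K := by
      have h := (Complex.abs_im_le_norm (s - s₀)).trans hs.le
      rw [Complex.sub_im] at h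
      have := abs_sub_abs_le_abs_sub (s.im - 2 * Real.pi * c ^ 2) (s₀.im - 2 * Real.pi * c ^ 2)
      rw [sub_sub_sub_cancel_right] at this
      simp only [K]; linarith
    have h3 := norm_integrand_le_exp n s u h1 h2
    have h4 := norm_log_line_le hc u
    -- The logarithm produced by differentiating in $s$ is absorbed into the exponential majorant.
    have h5 : c + |u| + 6 ≤ Real.exp (c + |u| + 6) := by
      linarith [Real.add_one_le_exp (c + |u| + 6)]
    refine (mul_le_mul (h4.trans h5) h3 (norm_nonneg _) (Real.exp_pos _).le).trans ?_
    rw [← Real.exp_add]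
    exact Real.exp_le_exp.2 (le_of_eq (by ring))

lemma differentiable_auxR : Differentiable ℂ auxR := by
  have : auxR = fun s => -lineIntegral 0 s := funext auxR_eq_neg_lineIntegral
  rw [this]
  exact (differentiable_lineIntegral 0).neg

/-! ### Moving the line across an integer -/

open Complex Topology in
/-- Moving the line of integration across a horizontal strip of holomorphy. -/
lemma integral_horizontal_line_eq {f : ℂ → ℂ} {a b : ℝ} (hab : a ≤ b)
    (hf : ∀ z : ℂ, a ≤ z.im → z.im ≤ b → DifferentiableAt ℂ f z)
    (ha : MeasureTheory.Integrable fun u : ℝ => f (u + a * I))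
    (hb : MeasureTheory.Integrable fun u : ℝ => f (u + b * I))
    {g : ℝ → ℝ} {R₀ : ℝ} (hg : Tendsto g atTop (𝓝 0))
    (hR : ∀ u y : ℝ, R₀ ≤ |u| → a ≤ y → y ≤ b → ‖f (u + y * I)‖ ≤ g |u|) :
    ∫ u : ℝ, f (u + a * I) = ∫ u : ℝ, f (u + b * I) := by
  have hrect : ∀ R : ℝ, (∫ x in (-R)..R, f (x + a * I)) - (∫ x in (-R)..R, f (x + b * I))
      = I * (∫ y in a..b, f ((-R : ℝ) + y * I)) - I * ∫ y in a..b, f (R + y * I) := fun R => by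
    have h := integral_boundary_rect_eq_zero_of_differentiableOn f (⟨-R, a⟩ : ℂ) ⟨R, b⟩ ?_
    · simp only [smul_eq_mul] at h
      linear_combination h
    · intro z hz
      rw [mem_reProdIm, Set.uIcc_of_le hab] at hz
      exact (hf z hz.2.1 hz.2.2).differentiableWithinAt
  have hv : ∀ σ : ℝ, |σ| = 1 →
      Tendsto (fun R : ℝ => I * ∫ y in a..b, f ((σ * R : ℝ) + y * I)) atTop (𝓝 0) := by
    intro σ hσ
    refine squeeze_zero_norm' (a := fun R => g R * |b - a|) ?_ (by simpa using hg.mul_const |b - a|)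
    filter_upwards [eventually_ge_atTop R₀, eventually_ge_atTop 0] with R hR1 hR0
    rw [norm_mul, norm_I, one_mul]
    have hσR : |σ * R| = R := by rw [abs_mul, hσ, one_mul, abs_of_nonneg hR0]
    refine intervalIntegral.norm_integral_le_of_norm_le_const fun y hy => ?_
    rw [Set.uIoc_of_le hab] at hy
    have := hR (σ * R) y (by rw [hσR]; exact hR1) hy.1.le hy.2
    rwa [hσR] at this
  have h1 := (hv (-1) (by simp)).sub (hv 1 (by simp))
  have h2 := (MeasureTheory.intervalIntegral_tendsto_integral ha tendsto_neg_atTop_atBot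
    tendsto_id).sub (MeasureTheory.intervalIntegral_tendsto_integral hb tendsto_neg_atTop_atBot
    tendsto_id)
  simp only [id, hrect] at h2
  simp only [neg_one_mul, one_mul, sub_zero] at h1
  exact sub_eq_zero.1 (tendsto_nhds_unique h2 h1)

lemma tendsto_exp_neg_sq_add {b : ℝ} (hb : 0 < b) (A B : ℝ) :
    Tendsto (fun u : ℝ => Real.exp (-b * u ^ 2 + A * u + B)) atTop (nhds 0) := by
  refine Real.tendsto_exp_atBot.comp ?_
  have h1 : Tendsto (fun u : ℝ => -b * u + A) atTop atBot :=
    tendsto_atBot_add_const_right _ _ (tendsto_id.const_mul_atTop_of_neg (neg_lt_zero.2 hb))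
  have h2 := tendsto_atBot_add_const_right _ B (tendsto_id.atTop_mul_atBot₀ h1)
  refine h2.congr fun u => ?_
  simp only [id]; ring

/-- The denominator `e^{πix} - e^{-πix}` of the integrand. -/
noncomputable def den (x : ℂ) : ℂ :=
  Complex.exp (Real.pi * Complex.I * x) - Complex.exp (-(Real.pi * Complex.I * x))

lemma differentiable_den : Differentiable ℂ den := by unfold den; fun_prop

lemma hasDerivAt_den (x : ℂ) : HasDerivAt den (Real.pi * Complex.I *
    (Complex.exp (Real.pi * Complex.I * x) + Complex.exp (-(Real.pi * Complex.I * x)))) x := by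
  have h : HasDerivAt (fun x : ℂ => Real.pi * Complex.I * x) (Real.pi * Complex.I) x := by
    simpa using (hasDerivAt_id x).const_mul (Real.pi * Complex.I : ℂ)
  refine (h.cexp.fun_sub h.fun_neg.cexp).congr_deriv ?_
  ring

lemma den_eq_zero_iff (x : ℂ) : den x = 0 ↔ ∃ n : ℤ, x = n := by
  rw [den, sub_eq_zero, Complex.exp_eq_exp_iff_exists_int]
  have hp : (Real.pi * Complex.I : ℂ) ≠ 0 := by simp [Real.pi_ne_zero]
  refine exists_congr fun n => ⟨fun h => ?_, fun h => ?_⟩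
  · refine mul_left_cancel₀ hp ?_
    linear_combination h / 2
  · rw [h]; ring

lemma den_natCast (n : ℕ) : den n = 0 := (den_eq_zero_iff _).2 ⟨n, by simp⟩

lemma deriv_den_natCast_ne_zero (n : ℕ) : deriv den n ≠ 0 := by
  have h0 := den_natCast n
  rw [den, sub_eq_zero] at h0
  rw [(hasDerivAt_den _).deriv, ← h0, ← two_mul]
  simp [Real.pi_ne_zero, Complex.exp_ne_zero]

/-- The integrand with its pole at `n` removed by subtracting a multiple of the integrand for
exponent zero. -/
noncomputable def regIntegrand (n : ℕ) (s x : ℂ) : ℂ :=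
  Complex.exp (Real.pi * Complex.I * x ^ 2) * dslope (fun x : ℂ => x ^ (-s)) n x / dslope den n x

/-- Subtracting $n^{-s}$ times the integrand for exponent $0$ cancels the pole at $n$. The shift
then needs no residue theorem, only the case $s=0$, which can be evaluated directly. -/
lemma regIntegrand_eq {n : ℕ} {x : ℂ} (hx : x ≠ n) (s : ℂ) :
    regIntegrand n s x = integrand s x - (n : ℂ) ^ (-s) * integrand 0 x := by
  have h : x - n ≠ 0 := sub_ne_zero.2 hx
  rw [regIntegrand, dslope_of_ne _ hx, dslope_of_ne _ hx, slope_def_field, slope_def_field,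
    den_natCast, sub_zero, integrand, integrand, ← den]
  simp only [neg_zero, Complex.cpow_zero, one_mul]
  rw [mul_div_assoc, div_div_div_cancel_right₀ h]
  ring

lemma dslope_den_ne_zero {n : ℕ} {x : ℂ} (hx : ∀ m : ℤ, m ≠ n → x ≠ m) :
    dslope den n x ≠ 0 := by
  by_cases h : x = n
  · rw [h, dslope_same]; exact deriv_den_natCast_ne_zero n
  · rw [dslope_of_ne _ h, slope_def_field, den_natCast, sub_zero]
    refine div_ne_zero (fun h0 => ?_) (sub_ne_zero.2 h)
    obtain ⟨m, hm⟩ := (den_eq_zero_iff x).1 h0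
    exact hx m (fun hmn => h (by rw [hm, hmn]; simp)) hm

lemma line_ne_int {n : ℕ} {c : ℝ} (hc : |c - n| < 1) (u : ℝ) (m : ℤ) (hm : m ≠ n) :
    line c u ≠ m := by
  intro h
  have h1 := congrArg Complex.re h
  have h2 := congrArg Complex.im h
  simp only [line_re, line_im, Complex.intCast_re, Complex.intCast_im] at h1 h2
  rw [h2, add_zero] at h1
  rw [h1] at hc
  have : |m - (n : ℤ)| < 1 := by exact_mod_cast hc
  exact hm (sub_eq_zero.1 (Int.abs_lt_one_iff.1 this))

lemma differentiableAt_regIntegrand {n : ℕ} (hn : 1 ≤ n) {c : ℝ} (hc : |c - n| < 1) (s : ℂ)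
    (u : ℝ) : DifferentiableAt ℂ (regIntegrand n s) (line c u) := by
  have hn' : (1 : ℝ) ≤ n := by exact_mod_cast hn
  have hc0 : 0 < c := by linarith [(abs_lt.1 hc).1]
  have hsl : Complex.slitPlane ∈ nhds (n : ℂ) :=
    Complex.isOpen_slitPlane.mem_nhds (by
      rw [Complex.mem_slitPlane_iff]; left; simp; linarith)
  have h1 : DifferentiableAt ℂ (dslope (fun x : ℂ => x ^ (-s)) n) (line c u) := by
    refine ((Complex.differentiableOn_dslope hsl).2 ?_).differentiableAt
      (Complex.isOpen_slitPlane.mem_nhds (line_mem_slitPlane hc0 u))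
    intro x hx
    exact ((hasDerivAt_id x).cpow_const hx).differentiableAt.differentiableWithinAt
  have h2 : DifferentiableAt ℂ (dslope den n) (line c u) :=
    ((Complex.differentiableOn_dslope univ_mem).2
      differentiable_den.differentiableOn).differentiableAt univ_mem
  unfold regIntegrand
  exact ((by fun_prop : DifferentiableAt ℂ
    (fun x : ℂ => Complex.exp (Real.pi * Complex.I * x ^ 2)) (line c u)).mul h1).div h2
    (dslope_den_ne_zero (line_ne_int hc u))

lemma one_le_norm_den {x : ℂ} (hx : 1 ≤ |x.im|) : 1 ≤ ‖den x‖ := by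
  refine le_of_sq_le_sq ?_ (norm_nonneg _)
  rw [den, normSq_exp_sub_exp_neg]
  have h1 : (Real.pi * Complex.I * x).re = -(Real.pi * x.im) := by simp
  rw [h1, mul_neg, Real.cosh_neg]
  have h4 := one_add_sq_div_two_le_cosh (2 * (Real.pi * x.im))
  have h5 := Real.cos_le_one (2 * (Real.pi * Complex.I * x).im)
  have h6 : 1 ≤ x.im ^ 2 := by rw [← sq_abs]; nlinarith
  nlinarith [Real.pi_gt_three, mul_le_mul Real.pi_gt_three.le Real.pi_gt_three.le (by norm_num)
    Real.pi_pos.le]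

/-- A crude bound, uniform over the lines between $n-\tfrac12$ and $n+\tfrac12$, that makes the ends
of the strip negligible. For $|v|\ge2$ the imaginary part has modulus at least $1$, which keeps the
denominator away from zero. -/
lemma norm_regIntegrand_le {n : ℕ} (hn : 1 ≤ n) {c : ℝ} (hc : |c - n| ≤ 1 / 2) (s : ℂ) {v : ℝ}
    (hv : 2 ≤ |v|) : ‖regIntegrand n s (line c v)‖ ≤ Real.exp (-Real.pi * v ^ 2 +
      (2 * Real.pi * (n + 1) + |s.re|) * |v| +
        (|s.re| * (n + 3) + Real.pi * |s.im| + ‖(n : ℂ) ^ (-s)‖)) := by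
  have hn' : (1 : ℝ) ≤ n := by exact_mod_cast hn
  obtain ⟨hc1, hc2⟩ := abs_le.1 hc
  have hc0 : 1 / 2 ≤ c := by linarith
  have hr : 1 / 2 < rt := by nlinarith [rt_sq, rt_pos]
  have him : 1 ≤ |(line c v).im| := by
    rw [line_im, abs_mul, abs_of_pos rt_pos]; nlinarith
  have hxn : line c v ≠ n := fun h => by
    rw [h] at him; simp at him; linarith
  have hden := one_le_norm_den him
  rw [den] at hden
  rw [regIntegrand_eq hxn, integrand, integrand]
  have hrew : ∀ A B E D : ℂ, A * E / D - B * (line c v ^ (-0 : ℂ) * E / D) = (A - B) * E / D := by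
    intro A B E D; simp; ring
  rw [hrew, norm_div, norm_mul, norm_exp_sq]
  refine (div_le_of_le_mul₀ (norm_nonneg _) (by positivity)
    (le_mul_of_one_le_right (by positivity) hden)).trans ?_
  have h1 : ‖line c v ^ (-s)‖ ≤ Real.exp (|s.re| * (c + |v| + 2) + Real.pi * |s.im|) := by
    rw [norm_cpow_neg (line_ne_zero (by linarith) v), Real.exp_add]
    have h := norm_line_rpow_le hc0 v (-s.re)
    rw [abs_neg] at h
    refine mul_le_mul h (Real.exp_le_exp.2 ((le_abs_self _).trans ?_)) (Real.exp_pos _).le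
      (Real.exp_pos _).le
    rw [abs_mul, mul_comm]
    exact mul_le_mul_of_nonneg_right (Complex.abs_arg_le_pi _) (abs_nonneg _)
  set w := |s.re| * (c + |v| + 2) + Real.pi * |s.im| with hw
  have hw0 : 0 ≤ w := by positivity
  set N := ‖(n : ℂ) ^ (-s)‖ with hN
  have h2 : ‖line c v ^ (-s) - (n : ℂ) ^ (-s)‖ ≤ Real.exp (w + N) := by
    refine (norm_sub_le _ _).trans ?_
    rw [Real.exp_add]
    have h3 := Real.add_one_le_exp N
    have h4 : 1 ≤ Real.exp w := Real.one_le_exp hw0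
    have h5 : 0 ≤ N := norm_nonneg _
    nlinarith [mul_le_mul_of_nonneg_left h3 (Real.exp_pos w).le]
  refine (mul_le_mul_of_nonneg_right h2 (Real.exp_pos _).le).trans ?_
  rw [← Real.exp_add]
  refine Real.exp_le_exp.2 ?_
  rw [line_re, line_im, hw]
  have h6 : (c + rt * v) * (rt * v) = v ^ 2 / 2 + c * (rt * v) := by
    have := rt_sq
    linear_combination v ^ 2 * this
  have h7 : -(c * (rt * v)) ≤ (n + 1) * |v| := by
    refine (neg_le_abs _).trans ?_
    rw [abs_mul, abs_mul, abs_of_pos rt_pos, abs_of_pos (by linarith : 0 < c)]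
    have := abs_nonneg v
    have h8 : rt * |v| ≤ |v| := mul_le_of_le_one_left this rt_lt_one.le
    have h9 : 0 ≤ rt * |v| := mul_nonneg rt_pos.le this
    nlinarith
  rw [h6]
  have h10 := mul_le_mul_of_nonneg_left h7 (show 0 ≤ 2 * Real.pi by positivity)
  have h11 : |s.re| * c ≤ |s.re| * (n + 1) := mul_le_mul_of_nonneg_left (by linarith) (abs_nonneg _)
  linarith

/-- A displacement $y$ perpendicular to the line moves the crossing point by $-2y\cdot$`rt` and the
parameter by $y$. In the rotated coordinate the change of line is a change of height. -/
lemma line_eq_rotate (c u y : ℝ) : line (c - 2 * rt * y) (u + y)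
    = c + Complex.exp (Real.pi * Complex.I / 4) * (u + y * Complex.I) := by
  rw [line_eq, exp_quarter]
  push_cast
  linear_combination (-(rt : ℂ) * y) * Complex.I_sq

lemma integral_regIntegrand_eq {n : ℕ} (hn : 1 ≤ n) (s : ℂ) :
    ∫ u : ℝ, regIntegrand n s (line (n + 1 / 2) u)
      = ∫ u : ℝ, regIntegrand n s (line (n - 1 / 2) u) := by
  have hn' : (1 : ℝ) ≤ n := by exact_mod_cast hn
  have hrt := rt_sq
  have hrt0 := rt_pos
  set Φ : ℂ → ℂ := fun z => regIntegrand n s (n + Complex.exp (Real.pi * Complex.I / 4) * z) with hΦ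
  have hΦ' : ∀ u y : ℝ, Φ (u + y * Complex.I) = regIntegrand n s (line (n - 2 * rt * y) (u + y)) :=
    fun u y => by rw [line_eq_rotate]; simp [hΦ]
  have hcy : ∀ y : ℝ, -(rt / 2) ≤ y → y ≤ rt / 2 → |(n - 2 * rt * y) - n| ≤ 1 / 2 := fun y h1 h2 => by
    rw [abs_le]; constructor <;> nlinarith
  have hint : ∀ c : ℝ, |c - n| = 1 / 2 →
      MeasureTheory.Integrable fun u => regIntegrand n s (line c u) := by
    intro c hc
    have hx : ∀ u, line c u ≠ n := fun u h => by
      have h1 := congrArg Complex.re h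
      have h2 := congrArg Complex.im h
      simp only [line_re, line_im, Complex.natCast_re, Complex.natCast_im] at h1 h2
      rw [h2, add_zero] at h1
      rw [h1] at hc; simp at hc
    simp only [fun u => regIntegrand_eq (hx u) s]
    have : ∃ m : ℕ, c = m + 1 / 2 := by
      rcases abs_cases (c - n) with h | h
      · exact ⟨n, by linarith⟩
      · refine ⟨n - 1, ?_⟩
        rw [Nat.cast_sub hn]; push_cast; linarith
    obtain ⟨m, rfl⟩ := this
    exact (integrable_integrand_line m s).sub ((integrable_integrand_line m 0).const_mul _)
  -- Since `rt`$^2=\tfrac12$, the heights $\mp$`rt`$/2$ correspond to the crossing points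
  -- $n\pm\tfrac12$.
  have e1 : (n - 2 * rt * (-(rt / 2)) : ℝ) = n + 1 / 2 := by linarith
  have e2 : (n - 2 * rt * (rt / 2) : ℝ) = n - 1 / 2 := by linarith
  have i1 : (∫ u : ℝ, Φ (u + (-(rt / 2) : ℝ) * Complex.I))
      = ∫ u : ℝ, regIntegrand n s (line (n + 1 / 2) u) := by
    simp only [hΦ', e1]
    exact MeasureTheory.integral_add_right_eq_self
      (fun u => regIntegrand n s (line (n + 1 / 2) u)) _
  have i2 : (∫ u : ℝ, Φ (u + (rt / 2 : ℝ) * Complex.I))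
      = ∫ u : ℝ, regIntegrand n s (line (n - 1 / 2) u) := by
    simp only [hΦ', e2]
    exact MeasureTheory.integral_add_right_eq_self
      (fun u => regIntegrand n s (line (n - 1 / 2) u)) _
  rw [← i1, ← i2]
  set A := 2 * Real.pi * (n + 1) + |s.re|
  set B := |s.re| * (n + 3) + Real.pi * |s.im| + ‖(n : ℂ) ^ (-s)‖
  refine integral_horizontal_line_eq (by linarith) ?_ ?_ ?_
    (tendsto_exp_neg_sq_add (half_pos Real.pi_pos) A (A + B + Real.pi)) (R₀ := 3) ?_
  · intro z h1 h2
    have h3 := differentiableAt_regIntegrand hn ((hcy z.im h1 h2).trans_lt (by norm_num)) s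
      (z.re + z.im)
    rw [line_eq_rotate] at h3
    simp only [Complex.ofReal_natCast, Complex.re_add_im] at h3
    exact DifferentiableAt.comp (f := fun z : ℂ => n + Complex.exp (Real.pi * Complex.I / 4) * z) z h3
      (by fun_prop)
  · simp only [hΦ', e1]
    exact (hint _ (by simp)).comp_add_right (-(rt / 2))
  · simp only [hΦ', e2]
    exact (hint _ (by rw [sub_sub_cancel_left]; simp)).comp_add_right (rt / 2)
  · intro u y hu h1 h2
    rw [hΦ']
    have hy : |y| ≤ 1 / 2 := abs_le.2 ⟨by linarith [rt_lt_one], by linarith [rt_lt_one]⟩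
    have hv1 : |u| ≤ |u + y| + |y| := by
      have := abs_sub_abs_le_abs_sub u (-y)
      rw [sub_neg_eq_add, abs_neg] at this; linarith
    have hv2 : |u + y| ≤ |u| + |y| := abs_add_le u y
    refine (norm_regIntegrand_le hn (hcy y h1 h2) s (by linarith)).trans (Real.exp_le_exp.2 ?_)
    -- Half of the Gaussian exponent is given up to replace $u+y$ by $u$ uniformly in $y$.
    have h5 : u ^ 2 / 2 - 1 ≤ (u + y) ^ 2 := by
      have : y ^ 2 ≤ 1 / 4 := by rw [← sq_abs]; nlinarith [abs_nonneg y]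
      nlinarith [sq_nonneg (u + 2 * y)]
    have hA : 0 ≤ A := by positivity
    have h6 : A * |u + y| ≤ A * (|u| + 1) := mul_le_mul_of_nonneg_left (by linarith) hA
    have h7 := mul_le_mul_of_nonneg_left h5 Real.pi_pos.le
    rw [sq_abs]
    linarith

/-- For $s=0$ a unit shift flips the sign of the denominator and multiplies the numerator by
$-e^{2\pi ix}$. The difference is divisible by the denominator, leaving a pure Gaussian. -/
lemma integrand_zero_add_one {x : ℂ} (hx : den x ≠ 0) : integrand 0 (x + 1) - integrand 0 x
    = Complex.exp (Real.pi * Complex.I * x ^ 2 + Real.pi * Complex.I * x) := by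
  have h1 : Complex.exp (Real.pi * Complex.I * (x + 1)) = -Complex.exp (Real.pi * Complex.I * x) := by
    rw [mul_add, Complex.exp_add, mul_one, Complex.exp_pi_mul_I]; ring
  have h2 : Complex.exp (-(Real.pi * Complex.I * (x + 1)))
      = -Complex.exp (-(Real.pi * Complex.I * x)) := by
    rw [Complex.exp_neg, h1, Complex.exp_neg, inv_neg]
  have h3 : Complex.exp (Real.pi * Complex.I * (x + 1) ^ 2)
      = -(Complex.exp (Real.pi * Complex.I * x ^ 2) * Complex.exp (Real.pi * Complex.I * x) ^ 2) := by
    have : Real.pi * Complex.I * (x + 1) ^ 2 = Real.pi * Complex.I * x ^ 2 +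
      (2 : ℕ) * (Real.pi * Complex.I * x) + Real.pi * Complex.I := by push_cast; ring
    rw [this, Complex.exp_add, Complex.exp_add, Complex.exp_pi_mul_I, Complex.exp_nat_mul]; ring
  have h4 : Complex.exp (Real.pi * Complex.I * x) * Complex.exp (-(Real.pi * Complex.I * x)) = 1 := by
    rw [← Complex.exp_add]; simp
  rw [den] at hx
  rw [integrand, integrand, h1, h2, h3, Complex.exp_add]
  simp only [neg_zero, Complex.cpow_zero, one_mul]
  have h5 : -Complex.exp (Real.pi * Complex.I * x) - -Complex.exp (-(Real.pi * Complex.I * x))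
      = -(Complex.exp (Real.pi * Complex.I * x) - Complex.exp (-(Real.pi * Complex.I * x))) := by ring
  rw [h5, neg_div_neg_eq, ← sub_div, div_eq_iff hx]
  linear_combination (Complex.exp (Real.pi * Complex.I * x ^ 2)) * h4

lemma exp_quarter_sq : Complex.exp (Real.pi * Complex.I / 4) ^ 2 = Complex.I := by
  rw [← Complex.exp_nat_mul]
  refine Eq.trans ?_ Complex.exp_pi_div_two_mul_I
  congr 1; push_cast; ring

/-- The Gaussian integral equals $e^{-\pi i/4}$, which cancels the direction factor of the line. -/
lemma lineIntegral_zero_succ_sub (n : ℕ) : lineIntegral (n + 1) 0 - lineIntegral n 0 = 1 := by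
  have hline : ∀ u, line (((n + 1 : ℕ) : ℝ) + 1 / 2) u = line (n + 1 / 2) u + 1 := fun u => by
    simp only [line]; push_cast; ring
  have e2 := exp_quarter_sq
  have e8 : Complex.exp (Real.pi * Complex.I / 4) * Complex.exp (-(Real.pi * Complex.I / 4)) = 1 := by
    rw [← Complex.exp_add]; simp
  rw [lineIntegral, lineIntegral, ← MeasureTheory.integral_sub
    ((integrable_integrand_line _ _).mul_const _) ((integrable_integrand_line _ _).mul_const _)]
  simp only [← sub_mul]
  rw [MeasureTheory.integral_mul_const]
  have hq : ∀ u : ℝ, integrand 0 (line (((n + 1 : ℕ) : ℝ) + 1 / 2) u)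
      - integrand 0 (line (n + 1 / 2) u) = Complex.exp ((-Real.pi : ℂ) * u ^ 2 +
        (Real.pi * Complex.I * Complex.exp (Real.pi * Complex.I / 4) * (2 * (n + 1 / 2) + 1)) * u
        + Real.pi * Complex.I * ((n + 1 / 2) ^ 2 + (n + 1 / 2))) := fun u => by
    rw [hline, integrand_zero_add_one (den_ne_zero n u)]
    congr 1
    simp only [line]; push_cast
    linear_combination (Real.pi * Complex.I * u ^ 2 : ℂ) * e2 + (Real.pi * u ^ 2 : ℂ) * Complex.I_sq
  simp only [hq]
  rw [integral_cexp_quadratic (by simp [Real.pi_pos])]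
  have hp : (Real.pi : ℂ) ≠ 0 := by simp [Real.pi_ne_zero]
  rw [neg_neg, div_self hp, Complex.one_cpow, one_mul]
  refine Eq.trans ?_ ((mul_comm _ _).trans e8)
  have hc : (Real.pi * Complex.I * Complex.exp (Real.pi * Complex.I / 4) *
      (2 * ((n : ℂ) + 1 / 2) + 1)) ^ 2 = -(Real.pi ^ 2 * Complex.I * (2 * n + 2) ^ 2) := by
    linear_combination (Real.pi ^ 2 * Complex.I ^ 2 * (2 * n + 2) ^ 2 : ℂ) * e2
      + (Real.pi ^ 2 * Complex.I * (2 * n + 2) ^ 2 : ℂ) * Complex.I_sq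
  rw [hc]
  congr 2
  field_simp
  ring

lemma lineIntegral_succ_sub (n : ℕ) (s : ℂ) :
    lineIntegral (n + 1) s - lineIntegral n s = ((n + 1 : ℕ) : ℂ) ^ (-s) := by
  have h := integral_regIntegrand_eq (Nat.le_add_left 1 n) s
  have hl : (((n + 1 : ℕ) : ℝ) - 1 / 2) = n + 1 / 2 := by push_cast; ring
  have hx : ∀ (m : ℕ) u, line (m + 1 / 2) u ≠ ((n + 1 : ℕ) : ℂ) := fun m u h => by
    have h1 := den_ne_zero m u
    rw [h] at h1
    exact h1 (den_natCast (n + 1))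
  rw [hl] at h
  simp only [fun m u => regIntegrand_eq (hx m u) s] at h
  rw [MeasureTheory.integral_sub (integrable_integrand_line _ _)
    ((integrable_integrand_line _ _).const_mul _), MeasureTheory.integral_sub
    (integrable_integrand_line _ _) ((integrable_integrand_line _ _).const_mul _),
    MeasureTheory.integral_const_mul, MeasureTheory.integral_const_mul] at h
  have h0 := lineIntegral_zero_succ_sub n
  simp only [lineIntegral, MeasureTheory.integral_mul_const] at h0 ⊢
  linear_combination (Complex.exp (Real.pi * Complex.I / 4)) * h + ((n + 1 : ℕ) : ℂ) ^ (-s) * h0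

lemma auxR_eq_sum_sub_lineIntegral (n : ℕ) (s : ℂ) :
    auxR s = ∑ k ∈ Finset.range n, ((k + 1 : ℕ) : ℂ) ^ (-s) - lineIntegral n s := by
  induction n with
  | zero => simp [auxR_eq_neg_lineIntegral]
  | succ n ih =>
    rw [Finset.sum_range_succ, ← lineIntegral_succ_sub, ih]; ring

/-! ### Size of the auxiliary function in the upper half-plane -/

/-- The choice is $n=\lfloor\sqrt{t/2\pi}\rfloor$, raised to $1$ for small $t$. Requiring $n\ge1$
gives $|x|\ge\tfrac32\cdot$`rt`$>1$ on the line, so that $|x|^{-\sigma}$ decays as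
$\sigma\to\infty$. -/
lemma exists_line_near_saddle {t : ℝ} (ht : 0 ≤ t) : ∃ n : ℕ, 1 ≤ n ∧ (n : ℝ) ≤ t + 2 ∧
    |t - 2 * Real.pi * ((n : ℝ) + 1 / 2) ^ 2| * (2 / ((n : ℝ) + 1 / 2)) ≤ 12 * Real.pi := by
  have hp := Real.pi_pos
  set c := √(t / (2 * Real.pi)) with hc
  have hc0 : 0 ≤ c := Real.sqrt_nonneg _
  have hsq : 2 * Real.pi * c ^ 2 = t := by
    rw [hc, Real.sq_sqrt (by positivity)]; field_simp
  have hct : c ≤ t + 1 := by nlinarith [Real.pi_gt_three, sq_nonneg (c - 1)]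
  -- Writing $t=2\pi c^2$, the quantity is $4\pi|c-c_n|(c+c_n)/c_n$ with $c_n=n+\tfrac12$; the
  -- factor $3$ turns it into $12\pi$.
  have key : ∀ n : ℕ, |c - ((n : ℝ) + 1 / 2)| * (c + ((n : ℝ) + 1 / 2)) ≤ 3 * ((n : ℝ) + 1 / 2) →
      |t - 2 * Real.pi * ((n : ℝ) + 1 / 2) ^ 2| * (2 / ((n : ℝ) + 1 / 2)) ≤ 12 * Real.pi := by
    intro n hn
    have hn0 : (0 : ℝ) < (n : ℝ) + 1 / 2 := by positivity
    have h1 : t - 2 * Real.pi * ((n : ℝ) + 1 / 2) ^ 2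
        = 2 * Real.pi * ((c - ((n : ℝ) + 1 / 2)) * (c + ((n : ℝ) + 1 / 2))) := by
      rw [← hsq]; ring
    rw [h1, abs_mul, abs_mul (c - _), abs_of_pos (by positivity : (0 : ℝ) < c + ((n : ℝ) + 1 / 2)),
      abs_of_pos (by positivity : 0 < 2 * Real.pi), mul_div_assoc', div_le_iff₀ hn0]
    nlinarith
  rcases lt_or_ge c 1 with h1 | h1
  · refine ⟨1, le_rfl, by push_cast; linarith, key 1 ?_⟩
    push_cast
    rw [abs_of_nonpos (by linarith)]
    nlinarith
  · have hf1 := Nat.floor_le hc0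
    have hf2 := Nat.lt_floor_add_one c
    have hf3 : (1 : ℝ) ≤ (⌊c⌋₊ : ℝ) := by exact_mod_cast (Nat.one_le_floor_iff c).2 h1
    refine ⟨⌊c⌋₊, (Nat.one_le_floor_iff c).2 h1, by linarith, key _ ?_⟩
    have : |c - ((⌊c⌋₊ : ℝ) + 1 / 2)| ≤ 1 / 2 := by rw [abs_le]; constructor <;> linarith
    nlinarith [abs_nonneg (c - ((⌊c⌋₊ : ℝ) + 1 / 2))]

lemma norm_lineIntegral_le {n : ℕ} {s : ℂ}
    (h : |s.im - 2 * Real.pi * ((n : ℝ) + 1 / 2) ^ 2| * (2 / ((n : ℝ) + 1 / 2)) ≤ 12 * Real.pi)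
    {A M : ℝ} (hM : ∀ u, ‖line (n + 1 / 2) u‖ ^ (-s.re) ≤ M * Real.exp (A * |u|)) :
    ‖lineIntegral n s‖ ≤
      M * ∫ u : ℝ, Real.exp (-(Real.pi / 2) * u ^ 2 + (A + 12 * Real.pi) * |u| + 0) := by
  rw [← MeasureTheory.integral_const_mul]
  refine MeasureTheory.norm_integral_le_of_norm_le
    ((integrable_exp_neg_sq_add (by positivity) _ _).const_mul _) (.of_forall fun u => ?_)
  have he : ‖Complex.exp (Real.pi * Complex.I / 4)‖ = 1 := by
    have h : (Real.pi * Complex.I / 4 : ℂ) = ((Real.pi / 4 : ℝ) : ℂ) * Complex.I := by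
      push_cast; ring
    rw [h, Complex.norm_exp_ofReal_mul_I]
  rw [norm_mul, he, mul_one]
  refine (norm_integrand_le n s u).trans ?_
  have h1 := mul_le_mul_of_nonneg_right h (abs_nonneg u)
  rw [← mul_assoc]
  refine (mul_le_mul (hM u) (Real.exp_le_exp.2 (add_le_add_right h1 _)) (Real.exp_pos _).le
    ((Real.rpow_nonneg (norm_nonneg _) _).trans (hM u))).trans (le_of_eq ?_)
  rw [mul_assoc, ← Real.exp_add]
  congr 2; ring

lemma sum_inv_sq_le (n : ℕ) : ∑ k ∈ Finset.range n, ((k : ℝ) + 2) ^ (-2 : ℝ) ≤ 1 - 1 / (n + 1) := by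
  induction n with
  | zero => simp
  | succ n ih =>
    rw [Finset.sum_range_succ]
    have h : ((n : ℝ) + 2) ^ (-2 : ℝ) ≤ 1 / (n + 1) - 1 / ((n + 1 : ℕ) + 1) := by
      have : ((n : ℝ) + 2) ^ (-2 : ℝ) = 1 / ((n : ℝ) + 2) ^ 2 := by
        rw [Real.rpow_neg (by positivity), one_div]; norm_cast
      rw [this, div_sub_div _ _ (by positivity) (by positivity),
        div_le_div_iff₀ (by positivity) (by positivity)]
      push_cast; nlinarith
    linarith

lemma one_lt_three_half_rt : 1 < 3 / 2 * rt := by nlinarith [rt_sq, rt_pos]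

lemma three_half_rt_le_norm_line {n : ℕ} (hn : 1 ≤ n) (u : ℝ) :
    3 / 2 * rt ≤ ‖line (n + 1 / 2) u‖ := by
  refine le_trans ?_ (mul_rt_le_norm_line _ u)
  have hn' : (1 : ℝ) ≤ n := by exact_mod_cast hn
  exact mul_le_mul_of_nonneg_right (by linarith) rt_pos.le

/-- Far to the right, uniformly in the upper half-plane, `auxR` is close to one. -/
lemma exists_norm_auxR_sub_one_le : ∃ σ₁ : ℝ, 2 ≤ σ₁ ∧ ∀ s : ℂ, σ₁ ≤ s.re → 0 ≤ s.im →
    ‖auxR s - 1‖ ≤ 1 / 2 := by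
  set C := ∫ u : ℝ, Real.exp (-(Real.pi / 2) * u ^ 2 + (0 + 12 * Real.pi) * |u| + 0) with hC
  have t1 : Tendsto (fun σ : ℝ => (3 / 2 * rt) ^ (-σ) * C) atTop (nhds 0) := by
    have h := (tendsto_rpow_atTop_of_base_lt_one (3 / 2 * rt)⁻¹
      (by have := rt_pos; have : 0 < (3 / 2 * rt)⁻¹ := by positivity
          linarith) (inv_lt_one_of_one_lt₀ one_lt_three_half_rt)).mul_const C
    rw [zero_mul] at h
    refine h.congr fun σ => ?_
    rw [Real.rpow_neg (by have := rt_pos; positivity), Real.inv_rpow (by have := rt_pos; positivity)]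
  have t2 : Tendsto (fun σ : ℝ => (2 : ℝ) ^ (-(σ - 2))) atTop (nhds 0) := by
    have h := (tendsto_rpow_atTop_of_base_lt_one (2 : ℝ)⁻¹ (by norm_num) (by norm_num)).comp
      (tendsto_atTop_add_const_right atTop (-2 : ℝ) tendsto_id)
    refine h.congr fun σ => ?_
    rw [Function.comp_apply, Real.inv_rpow (by norm_num), ← Real.rpow_neg (by norm_num)]; rfl
  have t3 := (t1.add t2).eventually (gt_mem_nhds (show (0 : ℝ) + 0 < 1 / 2 by norm_num))
  obtain ⟨σ₁, hσ⟩ := eventually_atTop.1 t3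
  refine ⟨max σ₁ 2, le_max_right _ _, fun s hs ht => ?_⟩
  have hs1 := hσ s.re ((le_max_left _ _).trans hs)
  have hs2 : 2 ≤ s.re := (le_max_right _ _).trans hs
  obtain ⟨n, hn1, -, hn⟩ := exists_line_near_saddle ht
  have h1 : ‖lineIntegral n s‖ ≤ (3 / 2 * rt) ^ (-s.re) * C := by
    refine norm_lineIntegral_le hn fun u => ?_
    rw [zero_mul, Real.exp_zero, mul_one]
    exact Real.rpow_le_rpow_of_nonpos (by linarith [one_lt_three_half_rt])
      (three_half_rt_le_norm_line hn1 u) (by linarith)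
  obtain ⟨m, rfl⟩ : ∃ m, n = m + 1 := ⟨n - 1, by omega⟩
  rw [auxR_eq_sum_sub_lineIntegral (m + 1) s, Finset.sum_range_succ']
  simp only [zero_add, Nat.cast_one, Complex.one_cpow]
  -- For $k\ge2$, $k^{-\sigma}\le2^{-(\sigma-2)}k^{-2}$, and $\sum_{k\ge2}k^{-2}\le1$ by
  -- telescoping.
  have h2 : ‖∑ k ∈ Finset.range m, ((k + 1 + 1 : ℕ) : ℂ) ^ (-s)‖ ≤ (2 : ℝ) ^ (-(s.re - 2)) := by
    refine (norm_sum_le _ _).trans ?_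
    have h3 : ∀ k ∈ Finset.range m, ‖((k + 1 + 1 : ℕ) : ℂ) ^ (-s)‖
        ≤ (2 : ℝ) ^ (-(s.re - 2)) * ((k : ℝ) + 2) ^ (-2 : ℝ) := fun k _ => by
      rw [Complex.norm_natCast_cpow_of_pos (by omega)]
      have e : ((k + 1 + 1 : ℕ) : ℝ) = (k : ℝ) + 2 := by push_cast; ring
      rw [e, Complex.neg_re]
      have : -s.re = -(s.re - 2) + (-2) := by ring
      rw [this, Real.rpow_add (by positivity)]
      refine mul_le_mul_of_nonneg_right ?_ (by positivity)
      exact Real.rpow_le_rpow_of_nonpos (by norm_num) (by linarith [Nat.cast_nonneg (α := ℝ) k])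
        (by linarith)
    refine (Finset.sum_le_sum h3).trans ?_
    rw [← Finset.mul_sum]
    refine mul_le_of_le_one_right (by positivity) ((sum_inv_sq_le m).trans ?_)
    have : (0 : ℝ) ≤ 1 / ((m : ℝ) + 1) := by positivity
    linarith
  have : ∀ a b : ℂ, a + 1 - b - 1 = a - b := fun a b => by ring
  rw [this]
  refine (norm_sub_le _ _).trans ?_
  linarith

/-- Polynomial growth of `auxR` in the upper half-plane to the right of a vertical line. -/
lemma exists_norm_auxR_le {A : ℝ} (hA : 0 ≤ A) : ∃ C : ℝ, 0 < C ∧ ∀ s : ℂ, -A ≤ s.re → 0 ≤ s.im →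
    ‖auxR s‖ ≤ C * (s.im + 3) ^ (A + 1) := by
  set D := ∫ u : ℝ, Real.exp (-(Real.pi / 2) * u ^ 2 + (A + 12 * Real.pi) * |u| + 0) with hD
  have hD0 : 0 ≤ D := MeasureTheory.integral_nonneg fun u => (Real.exp_pos _).le
  refine ⟨1 + D, by positivity, fun s hs ht => ?_⟩
  obtain ⟨n, hn1, hnt, hn⟩ := exists_line_near_saddle ht
  have hc1 : (1 : ℝ) ≤ (n : ℝ) + 1 / 2 := by
    have : (1 : ℝ) ≤ n := by exact_mod_cast hn1
    linarith
  have hT : (1 : ℝ) ≤ s.im + 3 := by linarith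
  have h1 : ‖lineIntegral n s‖ ≤ ((n : ℝ) + 1 / 2) ^ A * D := by
    refine norm_lineIntegral_le hn fun u => ?_
    have h2 : 1 ≤ ‖line (n + 1 / 2) u‖ :=
      one_lt_three_half_rt.le.trans (three_half_rt_le_norm_line hn1 u)
    refine (Real.rpow_le_rpow_of_exponent_le h2 (by linarith : -s.re ≤ A)).trans ?_
    have h3 : ‖line (n + 1 / 2) u‖ ≤ ((n : ℝ) + 1 / 2) * Real.exp |u| := by
      refine (norm_line_le (by linarith) u).trans ?_
      have := Real.add_one_le_exp |u|
      nlinarith [abs_nonneg u]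
    refine (Real.rpow_le_rpow (norm_nonneg _) h3 hA).trans ?_
    rw [Real.mul_rpow (by linarith) (Real.exp_pos _).le, ← Real.exp_mul, mul_comm |u|]
  have h4 : ((n : ℝ) + 1 / 2) ^ A ≤ (s.im + 3) ^ (A + 1) :=
    (Real.rpow_le_rpow (by linarith) (by linarith) hA).trans
      (Real.rpow_le_rpow_of_exponent_le hT (by linarith))
  -- There are $n\le t+2$ terms, each at most $(t+3)^A$; their number accounts for the extra $1$ in
  -- the exponent.
  have h5 : ‖∑ k ∈ Finset.range n, ((k + 1 : ℕ) : ℂ) ^ (-s)‖ ≤ (s.im + 3) ^ (A + 1) := by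
    have h6 : ∀ k ∈ Finset.range n, ‖((k + 1 : ℕ) : ℂ) ^ (-s)‖ ≤ (s.im + 3) ^ A := fun k hk => by
      rw [Complex.norm_natCast_cpow_of_pos (by omega), Complex.neg_re]
      have hk' : ((k + 1 : ℕ) : ℝ) ≤ n := by
        exact_mod_cast Nat.succ_le_of_lt (Finset.mem_range.1 hk)
      refine (Real.rpow_le_rpow_of_exponent_le (by simp) (by linarith : -s.re ≤ A)).trans ?_
      exact Real.rpow_le_rpow (by positivity) (by linarith) hA
    refine (norm_sum_le _ _).trans ((Finset.sum_le_card_nsmul _ _ _ h6).trans ?_)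
    rw [Finset.card_range, nsmul_eq_mul, Real.rpow_add (by linarith), Real.rpow_one, mul_comm]
    exact mul_le_mul_of_nonneg_left (by linarith) (by positivity)
  rw [auxR_eq_sum_sub_lineIntegral n s]
  refine (norm_sub_le _ _).trans ?_
  have := mul_le_mul_of_nonneg_right h4 hD0
  linarith

/-! ### The value at one half is not zero -/

lemma cpow_neg_half_polar {x : ℂ} (hx : x ≠ 0) :
    (x ^ (-(1 / 2) : ℂ)).re = ‖x ^ (-(1 / 2) : ℂ)‖ * Real.cos (x.arg / 2) ∧
    (x ^ (-(1 / 2) : ℂ)).im = -(‖x ^ (-(1 / 2) : ℂ)‖ * Real.sin (x.arg / 2)) := by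
  have h : (Complex.log x * -(1 / 2)).im = -(x.arg / 2) := by
    simp [Complex.mul_im, Complex.log_im]; ring
  rw [Complex.cpow_def_of_ne_zero hx, Complex.exp_re, Complex.exp_im, Complex.norm_exp, h,
    Real.cos_neg, Real.sin_neg]
  exact ⟨rfl, mul_neg _ _⟩

lemma cpow_neg_half_sq (x : ℂ) : (x ^ (-(1 / 2) : ℂ)) ^ 2 = x⁻¹ := by
  rw [← Complex.cpow_nat_mul, ← Complex.cpow_neg_one]
  congr 1; norm_num

/-- The principal inverse square root is at an acute angle to the real axis, quantitatively. -/
lemma re_cpow_neg_half_ge {x : ℂ} (hx : x ≠ 0) (h : -(rt * ‖x‖) ≤ x.re) :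
    0.38 * ‖x ^ (-(1 / 2) : ℂ)‖ ≤ (x ^ (-(1 / 2) : ℂ)).re := by
  set X := x ^ (-(1 / 2) : ℂ) with hX
  have hre : 0 ≤ X.re := by
    rw [hX, (cpow_neg_half_polar hx).1]
    refine mul_nonneg (norm_nonneg _) (Real.cos_nonneg_of_neg_pi_div_two_le_of_le ?_ ?_)
    · linarith [Complex.neg_pi_lt_arg x]
    · linarith [Complex.arg_le_pi x]
  refine le_of_sq_le_sq ?_ hre
  have hsq := cpow_neg_half_sq x
  rw [← hX] at hsq
  have hn : ‖X‖ ^ 2 = ‖x‖⁻¹ := by rw [← norm_pow, hsq, norm_inv]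
  have h1 : X.re ^ 2 - X.im ^ 2 = x.re / ‖x‖ ^ 2 := by
    have := congrArg Complex.re hsq
    rw [Complex.inv_re, Complex.normSq_eq_norm_sq] at this
    rw [← this, pow_two X, Complex.mul_re]; ring
  have h2 : X.re ^ 2 + X.im ^ 2 = ‖x‖⁻¹ := by
    rw [← hn, ← Complex.normSq_eq_norm_sq, Complex.normSq_apply]; ring
  have hx0 : 0 < ‖x‖ := norm_pos_iff.2 hx
  have h3 : -(rt * ‖x‖⁻¹) ≤ x.re / ‖x‖ ^ 2 := by
    rw [le_div_iff₀ (by positivity)]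
    have : -(rt * ‖x‖⁻¹) * ‖x‖ ^ 2 = -(rt * ‖x‖) := by field_simp
    linarith
  have h4 : 0 < ‖x‖⁻¹ := by positivity
  -- Half-angle formula: $(\mathrm{Re}\,X)^2\ge\tfrac12(1-\mathtt{rt})|X|^2$, and $0.38^2=0.1444$ is
  -- below $\tfrac12(1-0.7072)=0.1464$.
  have h5 : rt ≤ 0.7072 := by nlinarith [rt_sq, rt_pos]
  rw [mul_pow, hn]
  nlinarith

/-- The two points have midpoint $\tfrac12>0$, so their arguments differ by at most $\pi$. Their
inverse square roots then enclose an angle of at most $\pi/2$, and adding one cannot shorten the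
other. -/
lemma norm_le_norm_cpow_neg_half_add {q : ℝ} (hq : 0 < q) :
    ‖(⟨1 / 2 - q, -q⟩ : ℂ) ^ (-(1 / 2) : ℂ)‖ ≤
      ‖(⟨1 / 2 + q, q⟩ : ℂ) ^ (-(1 / 2) : ℂ) + (⟨1 / 2 - q, -q⟩ : ℂ) ^ (-(1 / 2) : ℂ)‖ := by
  set x : ℂ := ⟨1 / 2 + q, q⟩ with hx
  set y : ℂ := ⟨1 / 2 - q, -q⟩ with hy
  have hx0 : x ≠ 0 := fun h => hq.ne' (congrArg Complex.im h)
  have hy0 : y ≠ 0 := fun h => hq.ne' (by simpa [hy] using congrArg Complex.im h)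
  have ha : 0 ≤ x.arg := Complex.arg_nonneg_iff.2 hq.le
  have ha' : x.arg ≤ Real.pi := Complex.arg_le_pi x
  have hb : y.arg < 0 := Complex.arg_neg_iff.2 (by simpa [hy])
  have hb' : -Real.pi < y.arg := Complex.neg_pi_lt_arg y
  have hs : 0 ≤ Real.sin (x.arg - y.arg) := by
    rw [Real.sin_sub, Complex.sin_arg, Complex.sin_arg, Complex.cos_arg hx0, Complex.cos_arg hy0]
    have : x.im / ‖x‖ * (y.re / ‖y‖) - x.re / ‖x‖ * (y.im / ‖y‖) = q / (‖x‖ * ‖y‖) := by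
      simp only [hx, hy]; ring
    rw [this]; positivity
  have hd : x.arg - y.arg ≤ Real.pi := by
    by_contra! hlt
    have := Real.sin_neg_of_neg_of_neg_pi_lt (x := x.arg - y.arg - 2 * Real.pi) (by linarith)
      (by linarith)
    rw [Real.sin_sub_two_pi] at this
    linarith
  have hc : 0 ≤ Real.cos (x.arg / 2 - y.arg / 2) :=
    Real.cos_nonneg_of_neg_pi_div_two_le_of_le (by linarith) (by linarith)
  obtain ⟨p1, p2⟩ := cpow_neg_half_polar hx0
  obtain ⟨p3, p4⟩ := cpow_neg_half_polar hy0
  set X := x ^ (-(1 / 2) : ℂ)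
  set Y := y ^ (-(1 / 2) : ℂ)
  refine le_of_sq_le_sq ?_ (norm_nonneg _)
  rw [← Complex.normSq_eq_norm_sq, ← Complex.normSq_eq_norm_sq, Complex.normSq_add]
  have : (X * (starRingEnd ℂ) Y).re = ‖X‖ * ‖Y‖ * Real.cos (x.arg / 2 - y.arg / 2) := by
    rw [Real.cos_sub, Complex.mul_re, Complex.conj_re, Complex.conj_im, p1, p2, p3, p4]; ring
  rw [this]
  have h1 : 0 ≤ ‖X‖ * ‖Y‖ * Real.cos (x.arg / 2 - y.arg / 2) := by positivity
  have h2 := Complex.normSq_nonneg X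
  linarith

/-- The quotient `E / (E + E⁻¹)` with `E = exp(πiu e^{πi/4})`. -/
noncomputable def logisticFactor (u : ℝ) : ℂ :=
  Complex.exp (Real.pi * Complex.I * (u * Complex.exp (Real.pi * Complex.I / 4))) /
    (Complex.exp (Real.pi * Complex.I * (u * Complex.exp (Real.pi * Complex.I / 4))) +
      Complex.exp (-(Real.pi * Complex.I * (u * Complex.exp (Real.pi * Complex.I / 4)))))

lemma den_line_half (u : ℝ) : den (line (1 / 2) u) = Complex.I *
    (Complex.exp (Real.pi * Complex.I * (u * Complex.exp (Real.pi * Complex.I / 4))) +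
      Complex.exp (-(Real.pi * Complex.I * (u * Complex.exp (Real.pi * Complex.I / 4))))) := by
  have e : (Real.pi * Complex.I * line (1 / 2) u : ℂ) = Real.pi / 2 * Complex.I +
      Real.pi * Complex.I * (u * Complex.exp (Real.pi * Complex.I / 4)) := by
    simp only [line]; push_cast; ring
  rw [den, e, neg_add, Complex.exp_add, Complex.exp_add, Complex.exp_neg (Real.pi / 2 * Complex.I),
    Complex.exp_pi_div_two_mul_I, Complex.inv_I]
  ring

lemma two_le_norm_logistic_den (u : ℝ) :
    2 ≤ ‖Complex.exp (Real.pi * Complex.I * (u * Complex.exp (Real.pi * Complex.I / 4))) +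
      Complex.exp (-(Real.pi * Complex.I * (u * Complex.exp (Real.pi * Complex.I / 4))))‖ := by
  have h := two_le_norm_den 0 u
  rw [← den, Nat.cast_zero, zero_add, den_line_half, norm_mul, Complex.norm_I, one_mul] at h
  exact h

lemma logistic_den_ne_zero (u : ℝ) :
    Complex.exp (Real.pi * Complex.I * (u * Complex.exp (Real.pi * Complex.I / 4))) +
      Complex.exp (-(Real.pi * Complex.I * (u * Complex.exp (Real.pi * Complex.I / 4)))) ≠ 0 :=
  norm_pos_iff.1 (two_pos.trans_le (two_le_norm_logistic_den u))

lemma logisticFactor_add_neg (u : ℝ) : logisticFactor u + logisticFactor (-u) = 1 := by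
  have h := logistic_den_ne_zero u
  simp only [logisticFactor, Complex.ofReal_neg, neg_mul, mul_neg, neg_neg]
  rw [add_comm (Complex.exp (-(Real.pi * Complex.I *
    (u * Complex.exp (Real.pi * Complex.I / 4)))))
    (Complex.exp (Real.pi * Complex.I * (u * Complex.exp (Real.pi * Complex.I / 4)))),
    ← add_div, div_self h]

lemma norm_logisticFactor_le (u : ℝ) :
    ‖logisticFactor u‖ ≤ Real.exp (-(Real.pi * (rt * u))) / 2 := by
  rw [logisticFactor, norm_div]
  have e : ‖Complex.exp (Real.pi * Complex.I * (u * Complex.exp (Real.pi * Complex.I / 4)))‖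
      = Real.exp (-(Real.pi * (rt * u))) := by
    rw [Complex.norm_exp, exp_quarter]; congr 1; simp; ring
  rw [e]
  exact div_le_div_of_nonneg_left (Real.exp_pos _).le two_pos (two_le_norm_logistic_den u)

lemma integrand_half_line (u : ℝ) : integrand (1 / 2) (line (1 / 2) u) *
    Complex.exp (Real.pi * Complex.I / 4) =
      line (1 / 2) u ^ (-(1 / 2) : ℂ) * (Real.exp (-Real.pi * u ^ 2) : ℝ) * logisticFactor u := by
  have e2 := exp_quarter_sq
  have e1 : Complex.exp (Real.pi * Complex.I * line (1 / 2) u ^ 2) =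
      Complex.exp (Real.pi * Complex.I / 4) * (Real.exp (-Real.pi * u ^ 2) : ℝ) *
      Complex.exp (Real.pi * Complex.I * (u * Complex.exp (Real.pi * Complex.I / 4))) := by
    rw [Complex.ofReal_exp, ← Complex.exp_add, ← Complex.exp_add]
    congr 1
    simp only [line]; push_cast
    linear_combination (Real.pi * Complex.I * u ^ 2 : ℂ) * e2 + (Real.pi * u ^ 2 : ℂ) * Complex.I_sq
  have hd := logistic_den_ne_zero u
  rw [integrand, ← den, den_line_half, e1, logisticFactor]
  generalize Complex.exp (Real.pi * Complex.I * (u * Complex.exp (Real.pi * Complex.I / 4))) +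
      Complex.exp (-(Real.pi * Complex.I * (u * Complex.exp (Real.pi * Complex.I / 4)))) = S at hd
  generalize Complex.exp (Real.pi * Complex.I * (u * Complex.exp (Real.pi * Complex.I / 4))) = E
  generalize Complex.exp (Real.pi * Complex.I / 4) = e at e2
  generalize line (1 / 2) u ^ (-(1 / 2) : ℂ) = X
  have hI := Complex.I_ne_zero
  rw [div_mul_eq_mul_div, mul_div_assoc', div_eq_div_iff (mul_ne_zero hI hd) hd]
  linear_combination (X * (Real.exp (-Real.pi * u ^ 2) : ℝ) * E * S) * e2

/-- With $X,Y$ the inverse square roots at $u,-u$ and $D$ the logistic factor at $u$, the sum is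
$Y+D(X-Y)$. Here $\mathrm{Re}\,Y\ge0.38|Y|$, while $|D(X-Y)|\le0.35|Y|$. -/
lemma re_symmetrized_pos {u : ℝ} (hu : 0 < u) :
    0 < (line (1 / 2) u ^ (-(1 / 2) : ℂ) * logisticFactor u +
      line (1 / 2) (-u) ^ (-(1 / 2) : ℂ) * logisticFactor (-u)).re := by
  set q := rt * u with hq'
  have hq : 0 < q := mul_pos rt_pos hu
  have ex : line (1 / 2) u = ⟨1 / 2 + q, q⟩ := Complex.ext (by simp [hq']) (by simp [hq'])
  have ey : line (1 / 2) (-u) = ⟨1 / 2 - q, -q⟩ :=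
    Complex.ext (by simp [hq']; ring) (by simp [hq'])
  have hx0 : line (1 / 2) u ≠ 0 := line_ne_zero (by norm_num) u
  have hy0 : line (1 / 2) (-u) ≠ 0 := line_ne_zero (by norm_num) (-u)
  have hsum := norm_le_norm_cpow_neg_half_add hq
  rw [← ex, ← ey] at hsum
  have hyn := normSq_line (1 / 2) (-u)
  have hxn := normSq_line (1 / 2) u
  rw [← hq'] at hxn
  rw [mul_neg, ← hq'] at hyn
  have hre := re_cpow_neg_half_ge hy0 (by
    rw [line_re, mul_neg, ← hq']
    by_contra! hlt
    have h1 : 0 ≤ rt * ‖line (1 / 2) (-u)‖ := mul_nonneg rt_pos.le (norm_nonneg _)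
    have h2 : (rt * ‖line (1 / 2) (-u)‖) ^ 2 < (q - 1 / 2) ^ 2 :=
      pow_lt_pow_left₀ (by linarith) h1 two_ne_zero
    rw [mul_pow, rt_sq, hyn] at h2
    nlinarith)
  have sx := cpow_neg_half_sq (line (1 / 2) u)
  have sy := cpow_neg_half_sq (line (1 / 2) (-u))
  have hD := norm_logisticFactor_le u
  have hDD : logisticFactor (-u) = 1 - logisticFactor u := by rw [← logisticFactor_add_neg u]; ring
  rw [← hq'] at hD
  rw [hDD]
  set X := line (1 / 2) u ^ (-(1 / 2) : ℂ)
  set Y := line (1 / 2) (-u) ^ (-(1 / 2) : ℂ)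
  set D := logisticFactor u
  have hY0 : 0 < ‖Y‖ := norm_pos_iff.2 fun h => by
    rw [h, zero_pow two_ne_zero] at sy; exact hy0 (inv_eq_zero.1 sy.symm)
  have hx1 : 1 / 2 ≤ ‖line (1 / 2) u‖ := by
    refine le_of_sq_le_sq ?_ (norm_nonneg _)
    rw [hxn]; nlinarith
  have hdiff : ‖X - Y‖ ≤ 2 * (2 * q * (2 * rt)) * ‖Y‖ := by
    -- From $X^2-Y^2=1/x-1/y$; the factor $X+Y$ is then bounded below by $|Y|$.
    have h1 : (X - Y) * (X + Y) = (line (1 / 2) (-u) - line (1 / 2) u) * (line (1 / 2) u)⁻¹ * Y ^ 2 := by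
      rw [sy]; field_simp; linear_combination line (1 / 2) u * sx * line (1 / 2) (-u) - line (1 / 2) u * line (1 / 2) (-u) * sy + line (1 / 2) (-u) * (mul_inv_cancel₀ hx0) - line (1 / 2) u * (mul_inv_cancel₀ hy0)
    have h2 : ‖line (1 / 2) (-u) - line (1 / 2) u‖ = 2 * q * (2 * rt) := by
      have : line (1 / 2) (-u) - line (1 / 2) u = -((2 * u : ℝ) : ℂ) *
        Complex.exp (((Real.pi / 4 : ℝ) : ℂ) * Complex.I) := by
        have e : (Real.pi * Complex.I / 4 : ℂ) = ((Real.pi / 4 : ℝ) : ℂ) * Complex.I := by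
          push_cast; ring
        simp only [line, e]; push_cast; ring
      rw [this, norm_mul, Complex.norm_exp_ofReal_mul_I, norm_neg, Complex.norm_real,
        Real.norm_of_nonneg (by positivity), hq']
      linear_combination (-4 * u) * rt_sq
    have h3 := congrArg norm h1
    rw [norm_mul, norm_mul, norm_mul, norm_inv, norm_pow, h2] at h3
    have h4 : ‖line (1 / 2) u‖⁻¹ ≤ 2 := by
      rw [inv_le_comm₀ (by linarith) (by norm_num)]; linarith
    have h5 : ‖X - Y‖ * ‖Y‖ ≤ 2 * q * (2 * rt) * 2 * ‖Y‖ ^ 2 := by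
      refine (mul_le_mul_of_nonneg_left hsum (norm_nonneg _)).trans (h3.le.trans ?_)
      have := rt_pos
      gcongr
    nlinarith
  -- The maximum of $qe^{-\pi q}$ is $1/(\pi e)\approx0.117$, and $4\cdot0.7072\cdot0.1225<0.35$.
  have hexp : q * Real.exp (-(Real.pi * q)) ≤ 0.1225 := by
    have h1 := Real.add_one_le_exp (Real.pi * q - 1)
    have h2 : Real.exp (Real.pi * q - 1) * Real.exp (-(Real.pi * q)) = Real.exp (-1) := by
      rw [← Real.exp_add]; congr 1; ring
    have h3 := Real.exp_neg_one_lt_d9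
    have h4 : Real.pi * (q * Real.exp (-(Real.pi * q))) ≤ 0.3679 := by
      have := mul_le_mul_of_nonneg_right h1 (Real.exp_pos (-(Real.pi * q))).le
      linarith
    have h5 : 0 ≤ q * Real.exp (-(Real.pi * q)) := by positivity
    nlinarith [Real.pi_gt_d2]
  have hrt : rt ≤ 0.7072 := by nlinarith [rt_sq, rt_pos]
  have hE := Real.exp_pos (-(Real.pi * q))
  have hprod : ‖D * (X - Y)‖ ≤ 0.35 * ‖Y‖ := by
    rw [norm_mul]
    refine (mul_le_mul hD hdiff (norm_nonneg _) (by positivity)).trans ?_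
    have : Real.exp (-(Real.pi * q)) / 2 * (2 * (2 * q * (2 * rt)) * ‖Y‖)
      = 4 * rt * (q * Real.exp (-(Real.pi * q))) * ‖Y‖ := by ring
    rw [this]
    refine mul_le_mul_of_nonneg_right ?_ hY0.le
    have h5 : 0 ≤ q * Real.exp (-(Real.pi * q)) := by positivity
    nlinarith [rt_pos]
  have hfin : X * D + Y * (1 - D) = Y + D * (X - Y) := by ring
  rw [hfin, Complex.add_re]
  have := (abs_le.1 ((Complex.abs_re_le_norm (D * (X - Y))).trans hprod)).1
  linarith

/-- Folding the integral at $u=0$ makes the real part of the integrand positive for $u\ne0$; the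
sign of `auxR` is reversed by the downward direction of the path. -/
lemma re_auxR_half_neg : (auxR (1 / 2)).re < 0 := by
  set Ψ : ℝ → ℂ := fun u => integrand (1 / 2) (line ((0 : ℕ) + 1 / 2) u) *
    Complex.exp (Real.pi * Complex.I / 4) with hΨ
  have hint : MeasureTheory.Integrable Ψ := (integrable_integrand_line 0 (1 / 2)).mul_const _
  have hcont : Continuous Ψ := (continuous_integrand_line 0 (1 / 2)).mul_const _
  have hS : MeasureTheory.Integrable fun u => (Ψ u + Ψ (-u)).re := (hint.add hint.comp_neg).re
  have hpos' : ∀ u, 0 < u → 0 < (Ψ u + Ψ (-u)).re := fun u hu => by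
    simp only [hΨ, Nat.cast_zero, zero_add, integrand_half_line, neg_sq]
    have e : ∀ a b c d e : ℂ, a * e * b + c * e * d = e * (a * b + c * d) := by intros; ring
    rw [e, Complex.re_ofReal_mul]
    exact mul_pos (Real.exp_pos _) (re_symmetrized_pos hu)
  have hpos : ∀ u, u ≠ 0 → 0 < (Ψ u + Ψ (-u)).re := fun u hu => by
    rcases hu.lt_or_gt with h | h
    · have := hpos' (-u) (by linarith)
      rwa [neg_neg, add_comm] at this
    · exact hpos' u h
  have hpos0 : 0 ≤ᵐ[MeasureTheory.volume] fun u => (Ψ u + Ψ (-u)).re := by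
    filter_upwards [MeasureTheory.Measure.ae_ne MeasureTheory.volume 0] with u hu
    exact (hpos u hu).le
  have h1 : 0 < ∫ u, (Ψ u + Ψ (-u)).re := by
    rw [MeasureTheory.integral_pos_iff_support_of_nonneg_ae hpos0 hS]
    refine lt_of_lt_of_le (b := MeasureTheory.volume (Set.Ioi (0 : ℝ))) (by simp)
      (MeasureTheory.measure_mono fun u hu => (hpos' u hu).ne')
  have h2 : ∫ u, (Ψ u + Ψ (-u)).re = 2 * (∫ u, Ψ u).re := by
    have h3 := integral_re (hint.add hint.comp_neg)
    simp only [Pi.add_apply, RCLike.re_to_complex] at h3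
    rw [h3, MeasureTheory.integral_add hint hint.comp_neg,
      MeasureTheory.integral_neg_eq_self, Complex.add_re]
    ring
  rw [auxR_eq_neg_lineIntegral, Complex.neg_re, lineIntegral]
  simp only [hΨ] at h2 h1
  linarith

lemma auxR_half_ne_zero : auxR (1 / 2) ≠ 0 := fun h => by
  have := re_auxR_half_neg
  rw [h] at this; simp at this

/-! ### Zeros of entire functions and the local logarithmic derivative -/

/-- The polynomial with the zeros of `f` in `S`, counted with multiplicity. -/
noncomputable def zeroProd (f : ℂ → ℂ) (S : Finset ℂ) (z : ℂ) : ℂ :=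
  ∏ ρ ∈ S, (z - ρ) ^ analyticOrderNatAt f ρ

lemma differentiable_zeroProd (f : ℂ → ℂ) (S : Finset ℂ) : Differentiable ℂ (zeroProd f S) := by
  unfold zeroProd; fun_prop

lemma zeroProd_ne_zero {f : ℂ → ℂ} {S : Finset ℂ} {z : ℂ} (hz : z ∉ S) : zeroProd f S z ≠ 0 :=
  Finset.prod_ne_zero_iff.2 fun _ hρ =>
    pow_ne_zero _ (sub_ne_zero.2 (ne_of_mem_of_not_mem hρ hz).symm)

lemma analyticOrderAt_ne_top_of_entire {f : ℂ → ℂ} (hf : Differentiable ℂ f) {w : ℂ} (hw : f w ≠ 0)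
    (a : ℂ) : analyticOrderAt f a ≠ ⊤ := fun h => by
  rw [AnalyticOnNhd.analyticOrderAt_eq_top_iff_eq_zero a fun z => hf.analyticAt z] at h
  exact hw (congrFun h w)

/-- An entire function divided by the full power of `z - a` is entire. -/
lemma exists_entire_factor {f : ℂ → ℂ} (hf : Differentiable ℂ f) {w : ℂ} (hw : f w ≠ 0) (a : ℂ) :
    ∃ g : ℂ → ℂ, Differentiable ℂ g ∧ g a ≠ 0 ∧
      ∀ z, f z = (z - a) ^ analyticOrderNatAt f a * g z := by
  have htop := analyticOrderAt_ne_top_of_entire hf hw a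
  obtain ⟨g₀, hg₀, hga, hev⟩ := ((hf.analyticAt a).analyticOrderNatAt_eq_iff htop).1 rfl
  set m := analyticOrderNatAt f a with hm
  classical
  set g : ℂ → ℂ := Function.update (fun z => f z / (z - a) ^ m) a (g₀ a) with hg
  have hne : ∀ z, z ≠ a → g z = f z / (z - a) ^ m := fun z hz => Function.update_of_ne hz _ _
  have hgg : g =ᶠ[nhds a] g₀ := by
    filter_upwards [hev] with z hz
    by_cases h : z = a
    · rw [h, hg, Function.update_self]
    · rw [hne z h, hz, smul_eq_mul, mul_div_cancel_left₀ _ (pow_ne_zero _ (sub_ne_zero.2 h))]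
  refine ⟨g, fun z => ?_, by rwa [hg, Function.update_self], fun z => ?_⟩
  · by_cases h : z = a
    · rw [h]; exact (hg₀.congr hgg.symm).differentiableAt
    · have h1 : DifferentiableAt ℂ (fun z => f z / (z - a) ^ m) z :=
        (hf z).div (by fun_prop) (pow_ne_zero _ (sub_ne_zero.2 h))
      refine h1.congr_of_eventuallyEq ?_
      filter_upwards [isOpen_ne.mem_nhds h] with y hy using hne y hy
  · by_cases h : z = a
    · have h0 := hev.self_of_nhds
      rw [h, h0, smul_eq_mul, hgg.self_of_nhds]
    · rw [hne z h, mul_div_cancel₀ _ (pow_ne_zero _ (sub_ne_zero.2 h))]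

lemma exists_zeroProd_factor {f : ℂ → ℂ} (hf : Differentiable ℂ f) {w : ℂ} (hw : f w ≠ 0)
    (S : Finset ℂ) : ∃ g : ℂ → ℂ, Differentiable ℂ g ∧ (∀ z, f z = zeroProd f S z * g z) ∧
      ∀ ρ ∈ S, g ρ ≠ 0 := by
  classical
  induction S using Finset.induction_on with
  | empty => exact ⟨f, hf, fun z => by simp [zeroProd], by simp⟩
  | insert a S ha ih =>
    obtain ⟨g, hg, hfg, hgS⟩ := ih
    have hgw : g w ≠ 0 := fun h => hw (by rw [hfg w, h, mul_zero])
    obtain ⟨k, hk, hka, hgk⟩ := exists_entire_factor hg hgw a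
    -- The factors already removed do not vanish at the new point, so its order is the same for $f$
    -- and for the quotient.
    have hord : analyticOrderNatAt f a = analyticOrderNatAt g a := by
      rw [(hf.analyticAt a).analyticOrderNatAt_eq_iff (analyticOrderAt_ne_top_of_entire hf hw a)]
      refine ⟨fun z => zeroProd f S z * k z,
        ((differentiable_zeroProd f S).mul hk).analyticAt a,
        mul_ne_zero (zeroProd_ne_zero ha) hka, .of_forall fun z => ?_⟩
      rw [smul_eq_mul, hfg z, hgk z]; ring
    refine ⟨k, hk, fun z => ?_, fun ρ hρ => ?_⟩
    · rw [hfg z, hgk z, zeroProd, zeroProd, Finset.prod_insert ha, hord]; ring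
    · rcases Finset.mem_insert.1 hρ with rfl | h
      · exact hka
      · exact fun h0 => hgS ρ h (by rw [hgk ρ, h0, mul_zero])

lemma finite_zeros_of_isCompact {f : ℂ → ℂ} (hf : Differentiable ℂ f) {w : ℂ} (hw : f w ≠ 0)
    {K : Set ℂ} (hK : IsCompact K) : {z | z ∈ K ∧ f z = 0}.Finite := by
  have h : f ⁻¹' {0}ᶜ ∈ codiscrete ℂ :=
    AnalyticOnNhd.preimage_zero_mem_codiscrete (fun z _ => hf.analyticAt z) hw
  have h2 := hK.finite_sdiff_of_mem_codiscreteWithin (s := f ⁻¹' {0}ᶜ)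
    (codiscreteWithin_mono (Set.subset_univ K) h)
  refine h2.subset fun z hz => ⟨hz.1, by simp [hz.2]⟩

/-- The logarithmic derivative splits off the zeros in `S`. -/
lemma logDeriv_eq_sum_add {f g : ℂ → ℂ} {S : Finset ℂ} (hg : Differentiable ℂ g)
    (hfg : ∀ z, f z = zeroProd f S z * g z) {z : ℂ} (hz : z ∉ S) (hgz : g z ≠ 0) :
    logDeriv f z = ∑ ρ ∈ S, (analyticOrderNatAt f ρ : ℂ) * (z - ρ)⁻¹ + logDeriv g z := by
  have hfun : f = fun z => zeroProd f S z * g z := funext hfg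
  conv_lhs => rw [hfun]
  rw [logDeriv_mul z (zeroProd_ne_zero hz) hgz (differentiable_zeroProd f S z) (hg z)]
  congr 1
  unfold zeroProd
  rw [logDeriv_prod (f := fun ρ z => (z - ρ) ^ analyticOrderNatAt f ρ) (fun ρ hρ => pow_ne_zero _ (sub_ne_zero.2 (ne_of_mem_of_not_mem hρ hz).symm))
    (fun ρ _ => by fun_prop)]
  refine Finset.sum_congr rfl fun ρ _ => ?_
  rw [logDeriv_fun_pow (by fun_prop), logDeriv_apply]
  simp

lemma norm_zeroProd_le {f : ℂ → ℂ} {S : Finset ℂ} {z : ℂ} {r : ℝ} (h : ∀ ρ ∈ S, ‖z - ρ‖ ≤ r) :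
    ‖zeroProd f S z‖ ≤ r ^ ∑ ρ ∈ S, analyticOrderNatAt f ρ := by
  rw [zeroProd, norm_prod, ← Finset.prod_pow_eq_pow_sum]
  refine Finset.prod_le_prod (fun _ _ => norm_nonneg _) fun ρ hρ => ?_
  rw [norm_pow]; exact pow_le_pow_left₀ (norm_nonneg _) (h ρ hρ) _

lemma le_norm_zeroProd {f : ℂ → ℂ} {S : Finset ℂ} {z : ℂ} {r : ℝ} (hr : 0 ≤ r)
    (h : ∀ ρ ∈ S, r ≤ ‖z - ρ‖) : r ^ ∑ ρ ∈ S, analyticOrderNatAt f ρ ≤ ‖zeroProd f S z‖ := by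
  rw [zeroProd, norm_prod, ← Finset.prod_pow_eq_pow_sum]
  refine Finset.prod_le_prod (fun _ _ => by positivity) fun ρ hρ => ?_
  rw [norm_pow]; exact pow_le_pow_left₀ hr (h ρ hρ) _

/-- A zero-free function whose modulus is at most `M` times its value at the centre has its
logarithmic derivative bounded by a multiple of `log M` on half the disc. -/
lemma norm_logDeriv_le_of_zero_free {g : ℂ → ℂ} (hg : Differentiable ℂ g) {c : ℂ} {r M : ℝ}
    (hr : 0 < r) (hM : 1 < M) (hg0 : ∀ z ∈ Metric.ball c r, g z ≠ 0)
    (hgM : ∀ z ∈ Metric.ball c r, ‖g z‖ ≤ M * ‖g c‖) {z : ℂ} (hz : ‖z - c‖ ≤ r / 2) :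
    ‖logDeriv g z‖ ≤ 24 / r * Real.log M := by
  have hL : 0 < Real.log M := Real.log_pos hM
  have hc : c ∈ Metric.ball c r := Metric.mem_ball_self hr
  have hd : DifferentiableOn ℂ (logDeriv g) (Metric.ball c r) := fun z hz =>
    ((hg.deriv z).div (hg z) (hg0 z hz)).differentiableWithinAt
  -- The primitive $h$ of $g'/g$ with $h(c)=0$ is a logarithm of $g/g(c)$, so the bound on $|g|$
  -- becomes a bound on $\mathrm{Re}\,h$.
  obtain ⟨h, hhc, hh⟩ := hd.isExactOn_ball.with_val_at c 0
  have hconst : ∀ z ∈ Metric.ball c r, g z * Complex.exp (-h z) = g c := by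
    intro z hz
    have hder : ∀ w ∈ Metric.ball c r, HasDerivAt (fun w => g w * Complex.exp (-h w)) 0 w := by
      intro w hw
      refine ((hg w).hasDerivAt.fun_mul (hh w hw).fun_neg.cexp).congr_deriv ?_
      have := hg0 w hw
      rw [logDeriv_apply]; field_simp; ring
    have := (convex_ball c r).is_const_of_fderivWithin_eq_zero (𝕜 := ℂ)
      (fun w hw => (hder w hw).differentiableAt.differentiableWithinAt) (fun w hw => by
        rw [fderivWithin_of_isOpen Metric.isOpen_ball hw]
        ext; simp [(hder w hw).deriv]) hz hc
    rw [this, hhc]; simp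
  have hre : ∀ z ∈ Metric.ball c r, (h z).re ≤ Real.log M := by
    intro z hz
    have h1 := congrArg norm (hconst z hz)
    rw [norm_mul, Complex.norm_exp, Complex.neg_re] at h1
    have h2 := hgM z hz
    have h3 : 0 < ‖g z‖ := norm_pos_iff.2 (hg0 z hz)
    rw [← h1] at h2
    have h4 : 1 ≤ M * Real.exp (-(h z).re) := by
      have : ‖g z‖ * 1 ≤ ‖g z‖ * (M * Real.exp (-(h z).re)) := by linarith
      exact le_of_mul_le_mul_left this h3
    rw [Real.exp_neg, ← div_eq_mul_inv, one_le_div (Real.exp_pos _)] at h4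
    exact (Real.le_log_iff_exp_le (by linarith)).2 h4
  have hmem : ∀ w ∈ Metric.ball (0 : ℂ) r, c + w ∈ Metric.ball c r := fun w hw => by
    simpa [dist_eq_norm] using hw
  -- Borel–Carathéodory on radius $3r/4$ gives the factor $2\cdot\tfrac34/(1-\tfrac34)=6$. Cauchy's
  -- estimate on circles of radius $r/4$ then gives $24/r$.
  have hbound : ∀ y : ℂ, ‖y - c‖ ≤ 3 * r / 4 → ‖h y‖ ≤ 6 * Real.log M := by
    intro y hy
    have hyb : y - c ∈ Metric.ball (0 : ℂ) r := by
      rw [mem_ball_zero_iff]; linarith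
    have := Complex.borelCaratheodory_zero (f := fun w => h (c + w)) hL (R := r) (z := y - c)
      (fun w hw => by
        have h1 := (hh (c + w) (hmem w hw)).differentiableAt
        exact (DifferentiableAt.comp (f := fun w : ℂ => c + w) w h1
          (by fun_prop)).differentiableWithinAt)
      (fun w hw => hre _ (hmem w hw)) hr hyb (by simpa using hhc)
    simp only [add_sub_cancel] at this
    refine this.trans ?_
    rw [div_le_iff₀ (by linarith)]
    nlinarith
  have hzb : z ∈ Metric.ball c r := by rw [Metric.mem_ball, dist_eq_norm]; linarith
  have hcl : ∀ y ∈ Metric.closedBall z (r / 4), ‖y - c‖ ≤ 3 * r / 4 := fun y hy => by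
    rw [Metric.mem_closedBall, dist_eq_norm] at hy
    have : y - c = (y - z) + (z - c) := by ring
    rw [this]
    exact (norm_add_le _ _).trans (by linarith)
  rw [← (hh z hzb).deriv]
  refine (Complex.norm_deriv_le_of_forall_mem_sphere_norm_le (by positivity : 0 < r / 4)
    (DifferentiableOn.diffContOnCl_ball (U := Metric.ball c r) (fun y hy =>
      (hh y hy).differentiableAt.differentiableWithinAt) (fun y hy => by
        rw [Metric.mem_ball, dist_eq_norm]
        linarith [hcl y hy]))
    (fun y hy => hbound y (hcl y (Metric.sphere_subset_closedBall hy)))).trans (le_of_eq ?_)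
  field_simp; norm_num

/-- Local decomposition of the logarithmic derivative of an entire function in a disc. -/
lemma exists_local_decomposition {f : ℂ → ℂ} (hf : Differentiable ℂ f) {c : ℂ} (hc : f c ≠ 0)
    {r M : ℝ} (hr : 0 < r) (hM : 1 < M)
    (hfM : ∀ z, ‖z - c‖ ≤ 3 * r → ‖f z‖ ≤ M * ‖f c‖) :
    ∃ (S : Finset ℂ) (g : ℂ → ℂ), (∀ ρ, ρ ∈ S ↔ ‖ρ - c‖ ≤ r ∧ f ρ = 0) ∧
      ((∑ ρ ∈ S, analyticOrderNatAt f ρ : ℕ) : ℝ) * Real.log 2 ≤ Real.log M ∧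
      Differentiable ℂ g ∧ (∀ z, f z = zeroProd f S z * g z) ∧
      (∀ z, ‖z - c‖ ≤ r → g z ≠ 0) ∧
      ∀ z, ‖z - c‖ ≤ r / 2 → ‖logDeriv g z‖ ≤ 24 / r * Real.log M := by
  have hfin := finite_zeros_of_isCompact hf hc (isCompact_closedBall c r)
  set S := hfin.toFinset with hS
  have hSmem : ∀ ρ, ρ ∈ S ↔ ‖ρ - c‖ ≤ r ∧ f ρ = 0 := fun ρ => by
    rw [hS, Set.Finite.mem_toFinset, Set.mem_ofPred_eq, Metric.mem_closedBall, dist_eq_norm]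
  obtain ⟨g, hg, hfg, hgS⟩ := exists_zeroProd_factor hf hc S
  have hg0 : ∀ z, ‖z - c‖ ≤ r → g z ≠ 0 := fun z hz h0 =>
    hgS z ((hSmem z).2 ⟨hz, by rw [hfg z, h0, mul_zero]⟩) h0
  set N := ∑ ρ ∈ S, analyticOrderNatAt f ρ with hN
  have hgc : 0 < ‖g c‖ := norm_pos_iff.2 (hg0 c (by simpa using hr.le))
  have hfc : ‖f c‖ ≤ r ^ N * ‖g c‖ := by
    rw [hfg c, norm_mul]
    refine mul_le_mul_of_nonneg_right (norm_zeroProd_le fun ρ hρ => ?_) hgc.le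
    rw [norm_sub_rev]; exact ((hSmem ρ).1 hρ).1
  -- Jensen's idea: a zero in the inner disc is at distance at least $2r$ from the circle of radius
  -- $3r$ and at most $r$ from $c$, which gains a factor $2$ per zero. At $z=c$ this bounds the
  -- number of zeros; elsewhere it bounds the zero-free factor.
  have hmax : ∀ z, ‖z - c‖ ≤ 3 * r → ‖g z‖ * 2 ^ N ≤ M * ‖g c‖ := by
    intro z hz
    have hz' : z ∈ closure (Metric.ball c (3 * r)) := by
      rw [closure_ball _ (by positivity), Metric.mem_closedBall, dist_eq_norm]; exact hz
    have := Complex.norm_le_of_forall_mem_frontier_norm_le (C := M * ‖g c‖ / 2 ^ N)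
      Metric.isBounded_ball hg.diffContOnCl (fun y hy => ?_) hz'
    · rwa [le_div_iff₀ (by positivity)] at this
    · rw [frontier_ball _ (by positivity), mem_sphere_iff_norm] at hy
      have h1 : (2 * r) ^ N ≤ ‖zeroProd f S y‖ := le_norm_zeroProd (by positivity) fun ρ hρ => by
        have h2 := ((hSmem ρ).1 hρ).1
        have h3 := norm_sub_norm_le (y - c) (ρ - c)
        rw [sub_sub_sub_cancel_right] at h3
        linarith
      have h2 := hfM y hy.le
      rw [hfg y, norm_mul] at h2
      have h3 : (2 * r) ^ N * ‖g y‖ ≤ M * (r ^ N * ‖g c‖) :=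
        (mul_le_mul_of_nonneg_right h1 (norm_nonneg _)).trans
          (h2.trans (mul_le_mul_of_nonneg_left hfc (by linarith)))
      rw [le_div_iff₀ (by positivity)]
      rw [mul_pow] at h3
      refine le_of_mul_le_mul_left (a := r ^ N) ?_ (by positivity)
      linarith
  refine ⟨S, g, hSmem, ?_, hg, hfg, hg0, fun z hz => ?_⟩
  · have h1 := hmax c (by simp; positivity)
    have h2 : (2 : ℝ) ^ N ≤ M := le_of_mul_le_mul_left (by linarith) hgc
    rw [← Real.log_pow]
    exact Real.log_le_log (by positivity) h2
  · refine norm_logDeriv_le_of_zero_free hg hr hM (fun y hy => ?_) (fun y hy => ?_) hz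
    · rw [Metric.mem_ball, dist_eq_norm] at hy
      exact hg0 y hy.le
    · rw [Metric.mem_ball, dist_eq_norm] at hy
      refine le_trans ?_ (hmax y (by linarith))
      exact le_mul_of_one_le_right (norm_nonneg _) (one_le_pow₀ one_le_two)

/-! ### The argument principle with zeros on the boundary -/

/-- The integral of the imaginary part of `F` along a horizontal segment at height `y`. -/
noncomputable def hor (F : ℂ → ℂ) (a b y : ℝ) : ℝ := ∫ x in a..b, (F (x + y * Complex.I)).im

/-- The integral of the real part of `F` along a vertical segment with abscissa `x`. -/
noncomputable def ver (F : ℂ → ℂ) (x p q : ℝ) : ℝ := ∫ y in p..q, (F (x + y * Complex.I)).re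

lemma integral_div_sq_add_sq (k x₀ p q : ℝ) : ∫ x in p..q, k / ((x - x₀) ^ 2 + k ^ 2)
    = Real.arctan ((q - x₀) / k) - Real.arctan ((p - x₀) / k) := by
  -- When the pole lies on the line of the segment, the integrand is identically $0$ and both
  -- arctangents are $\arctan(x/0)=0$ by convention. The formula thus also covers zeros on an edge.
  rcases eq_or_ne k 0 with rfl | hk
  · simp
  have hpos : ∀ x : ℝ, 0 < (x - x₀) ^ 2 + k ^ 2 := fun x => by positivity
  refine intervalIntegral.integral_eq_sub_of_hasDerivAt (f := fun x => Real.arctan ((x - x₀) / k))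
    (fun x _ => ?_) ?_
  · refine ((((hasDerivAt_id x).sub_const x₀).div_const k).arctan).congr_deriv ?_
    have := (hpos x).ne'
    simp only [id]
    have h2 : 1 + ((x - x₀) / k) ^ 2 = ((x - x₀) ^ 2 + k ^ 2) / k ^ 2 := by field_simp; ring
    rw [h2]
    field_simp
  · refine (Continuous.div continuous_const (by fun_prop) fun x => (hpos x).ne').intervalIntegrable
      _ _

lemma intervalIntegrable_div_sq_add_sq (k x₀ p q : ℝ) :
    IntervalIntegrable (fun x => k / ((x - x₀) ^ 2 + k ^ 2)) MeasureTheory.volume p q := by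
  rcases eq_or_ne k 0 with rfl | hk
  · simp
  · have hpos : ∀ x : ℝ, 0 < (x - x₀) ^ 2 + k ^ 2 := fun x => by positivity
    exact (Continuous.div continuous_const (by fun_prop) fun x => (hpos x).ne').intervalIntegrable
      _ _

lemma im_inv_sub (x y : ℝ) (ρ : ℂ) : ((x + y * Complex.I - ρ)⁻¹).im
    = (ρ.im - y) / ((x - ρ.re) ^ 2 + (ρ.im - y) ^ 2) := by
  rw [Complex.inv_im, Complex.normSq_apply]
  simp
  congr 1
  ring

lemma re_inv_sub (x y : ℝ) (ρ : ℂ) : ((x + y * Complex.I - ρ)⁻¹).re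
    = (x - ρ.re) / ((y - ρ.im) ^ 2 + (x - ρ.re) ^ 2) := by
  rw [Complex.inv_re, Complex.normSq_apply]
  simp
  congr 1
  ring

lemma hor_inv_sub (ρ : ℂ) (a b y : ℝ) : hor (fun z => (z - ρ)⁻¹) a b y
    = Real.arctan ((b - ρ.re) / (ρ.im - y)) - Real.arctan ((a - ρ.re) / (ρ.im - y)) := by
  simp only [hor, im_inv_sub]
  exact integral_div_sq_add_sq _ _ _ _

lemma ver_inv_sub (ρ : ℂ) (x p q : ℝ) : ver (fun z => (z - ρ)⁻¹) x p q
    = Real.arctan ((q - ρ.im) / (x - ρ.re)) - Real.arctan ((p - ρ.im) / (x - ρ.re)) := by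
  simp only [ver, re_inv_sub]
  exact integral_div_sq_add_sq _ _ _ _

lemma ae_hor_notMem (S : Finset ℂ) (y : ℝ) :
    ∀ᵐ x : ℝ, (x + y * Complex.I : ℂ) ∉ S := by
  have : {x : ℝ | (x + y * Complex.I : ℂ) ∈ S}.Finite :=
    Set.Finite.preimage (s := (S : Set ℂ)) (fun a _ b _ h => by simpa using h) S.finite_toSet
  exact this.countable.ae_notMem _

lemma ae_ver_notMem (S : Finset ℂ) (x : ℝ) :
    ∀ᵐ y : ℝ, (x + y * Complex.I : ℂ) ∉ S := by
  have : {y : ℝ | (x + y * Complex.I : ℂ) ∈ S}.Finite :=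
    Set.Finite.preimage (s := (S : Set ℂ)) (fun a _ b _ h => by simpa using h) S.finite_toSet
  exact this.countable.ae_notMem _

lemma continuousAt_logDeriv {g : ℂ → ℂ} (hg : Differentiable ℂ g) {z : ℂ} (hz : g z ≠ 0) :
    ContinuousAt (logDeriv g) z :=
  ((hg.deriv z).continuousAt.div (hg z).continuousAt hz)

lemma hor_logDeriv_eq {f g : ℂ → ℂ} {S : Finset ℂ} (hg : Differentiable ℂ g)
    (hfg : ∀ z, f z = zeroProd f S z * g z) {a b y : ℝ}
    (hg0 : ∀ x ∈ Set.uIcc a b, g (x + y * Complex.I) ≠ 0) :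
    hor (logDeriv f) a b y = ∑ ρ ∈ S, (analyticOrderNatAt f ρ : ℝ) *
      (Real.arctan ((b - ρ.re) / (ρ.im - y)) - Real.arctan ((a - ρ.re) / (ρ.im - y)))
      + hor (logDeriv g) a b y := by
  simp only [← hor_inv_sub]
  have hi : ∀ ρ : ℂ, IntervalIntegrable (fun x : ℝ => ((x + y * Complex.I - ρ)⁻¹).im)
      MeasureTheory.volume a b := fun ρ => by
    simp only [im_inv_sub]; exact intervalIntegrable_div_sq_add_sq _ _ _ _
  have hgi : IntervalIntegrable (fun x : ℝ => (logDeriv g (x + y * Complex.I)).im)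
      MeasureTheory.volume a b := by
    refine ContinuousOn.intervalIntegrable fun x hx => ContinuousAt.continuousWithinAt ?_
    exact Complex.continuous_im.continuousAt.comp (ContinuousAt.comp
      (f := fun x : ℝ => (x + y * Complex.I : ℂ)) (continuousAt_logDeriv hg (hg0 x hx))
      (by fun_prop))
  simp only [hor, ← intervalIntegral.integral_const_mul]
  rw [← intervalIntegral.integral_finsetSum fun ρ _ => (hi ρ).const_mul _,
    ← intervalIntegral.integral_add _ hgi]
  · refine intervalIntegral.integral_congr_ae ?_
    filter_upwards [ae_hor_notMem S y] with x hx hxm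
    rw [logDeriv_eq_sum_add hg hfg hx (hg0 x (Set.uIoc_subset_uIcc hxm))]
    simp only [Complex.add_im, Complex.im_sum, ← Complex.ofReal_natCast, Complex.im_ofReal_mul]
  · simpa only [Finset.sum_fn] using IntervalIntegrable.sum S fun ρ _ => (hi ρ).const_mul _

lemma ver_logDeriv_eq {f g : ℂ → ℂ} {S : Finset ℂ} (hg : Differentiable ℂ g)
    (hfg : ∀ z, f z = zeroProd f S z * g z) {x p q : ℝ}
    (hg0 : ∀ y ∈ Set.uIcc p q, g (x + y * Complex.I) ≠ 0) :
    ver (logDeriv f) x p q = ∑ ρ ∈ S, (analyticOrderNatAt f ρ : ℝ) *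
      (Real.arctan ((q - ρ.im) / (x - ρ.re)) - Real.arctan ((p - ρ.im) / (x - ρ.re)))
      + ver (logDeriv g) x p q := by
  simp only [← ver_inv_sub]
  have hi : ∀ ρ : ℂ, IntervalIntegrable (fun y : ℝ => ((x + y * Complex.I - ρ)⁻¹).re)
      MeasureTheory.volume p q := fun ρ => by
    simp only [re_inv_sub]; exact intervalIntegrable_div_sq_add_sq _ _ _ _
  have hgi : IntervalIntegrable (fun y : ℝ => (logDeriv g (x + y * Complex.I)).re)
      MeasureTheory.volume p q := by
    refine ContinuousOn.intervalIntegrable fun y hy => ContinuousAt.continuousWithinAt ?_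
    exact Complex.continuous_re.continuousAt.comp (ContinuousAt.comp
      (f := fun y : ℝ => (x + y * Complex.I : ℂ)) (continuousAt_logDeriv hg (hg0 y hy))
      (by fun_prop))
  simp only [ver, ← intervalIntegral.integral_const_mul]
  rw [← intervalIntegral.integral_finsetSum fun ρ _ => (hi ρ).const_mul _,
    ← intervalIntegral.integral_add _ hgi]
  · refine intervalIntegral.integral_congr_ae ?_
    filter_upwards [ae_ver_notMem S x] with y hy hym
    rw [logDeriv_eq_sum_add hg hfg hy (hg0 y (Set.uIoc_subset_uIcc hym))]
    simp only [Complex.add_re, Complex.re_sum, ← Complex.ofReal_natCast, Complex.re_ofReal_mul]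
  · simpa only [Finset.sum_fn] using IntervalIntegrable.sum S fun ρ _ => (hi ρ).const_mul _

/-- Cauchy's theorem for a rectangle, imaginary part. -/
lemma rect_eq_zero {F : ℂ → ℂ} {a b p q : ℝ} (hab : a ≤ b) (hpq : p ≤ q)
    (hF : ∀ z : ℂ, a ≤ z.re → z.re ≤ b → p ≤ z.im → z.im ≤ q → DifferentiableAt ℂ F z) :
    hor F a b p + ver F b p q - hor F a b q - ver F a p q = 0 := by
  have h := Complex.integral_boundary_rect_eq_zero_of_differentiableOn F ⟨a, p⟩ ⟨b, q⟩ (by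
    intro z hz
    rw [Complex.mem_reProdIm, Set.uIcc_of_le hab, Set.uIcc_of_le hpq] at hz
    exact (hF z hz.1.1 hz.1.2 hz.2.1 hz.2.2).differentiableWithinAt)
  have hh : ∀ y, p ≤ y → y ≤ q → IntervalIntegrable (fun x : ℝ => F (x + y * Complex.I))
      MeasureTheory.volume a b := fun y h1 h2 => by
    refine ContinuousOn.intervalIntegrable fun x hx => ContinuousAt.continuousWithinAt ?_
    rw [Set.uIcc_of_le hab] at hx
    exact ContinuousAt.comp (f := fun x : ℝ => (x + y * Complex.I : ℂ))
      (hF _ (by simpa using hx.1) (by simpa using hx.2) (by simpa) (by simpa)).continuousAt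
      (by fun_prop)
  have hv : ∀ x, a ≤ x → x ≤ b → IntervalIntegrable (fun y : ℝ => F (x + y * Complex.I))
      MeasureTheory.volume p q := fun x h1 h2 => by
    refine ContinuousOn.intervalIntegrable fun y hy => ContinuousAt.continuousWithinAt ?_
    rw [Set.uIcc_of_le hpq] at hy
    exact ContinuousAt.comp (f := fun y : ℝ => (x + y * Complex.I : ℂ))
      (hF _ (by simpa) (by simpa) (by simpa using hy.1) (by simpa using hy.2)).continuousAt
      (by fun_prop)
  have e1 : ∀ y, p ≤ y → y ≤ q →
      (∫ x in a..b, F (x + y * Complex.I)).im = hor F a b y := fun y h1 h2 =>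
    (Complex.imCLM.intervalIntegral_comp_comm (hh y h1 h2)).symm
  have e2 : ∀ x, a ≤ x → x ≤ b →
      (∫ y in p..q, F (x + y * Complex.I)).re = ver F x p q := fun x h1 h2 =>
    (Complex.reCLM.intervalIntegral_comp_comm (hv x h1 h2)).symm
  have h3 := congrArg Complex.im h
  simp only [Complex.add_im, Complex.sub_im, smul_eq_mul, Complex.I_mul_im, Complex.zero_im] at h3
  rw [e1 p le_rfl hpq, e1 q hpq le_rfl, e2 b hab le_rfl, e2 a le_rfl hab] at h3
  linarith

/-- The angle contributed at one corner of the rectangle by its two adjacent edges. With $x/0=0$ it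
drops out when the point lies on the line of either edge, as boundary zeros require. -/
lemma arctan_div_add_arctan_div (x y : ℝ) (hx : 0 ≤ x) (hy : 0 ≤ y) :
    Real.arctan (x / y) + Real.arctan (y / x) =
      open Classical in if 0 < x ∧ 0 < y then Real.pi / 2 else 0 := by
  rcases hx.eq_or_lt with rfl | hx
  · simp
  rcases hy.eq_or_lt with rfl | hy
  · simp
  rw [if_pos ⟨hx, hy⟩, ← inv_div y x, Real.arctan_inv_of_pos (div_pos hy hx)]
  ring

/-- The total angle `2π`, `π`, `π/2` under which a rectangle with lower side on the real axis is
seen from one of its points. -/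
noncomputable def angle (a b T : ℝ) (ρ : ℂ) : ℝ :=
  open Classical in
  (if 0 < ρ.re - a ∧ 0 < ρ.im then Real.pi / 2 else 0) +
  (if 0 < ρ.re - a ∧ 0 < T - ρ.im then Real.pi / 2 else 0) +
  (if 0 < b - ρ.re ∧ 0 < ρ.im then Real.pi / 2 else 0) +
  (if 0 < b - ρ.re ∧ 0 < T - ρ.im then Real.pi / 2 else 0)

/-- The argument principle for a rectangle, zeros on the boundary being weighted by angles. -/
lemma rect_logDeriv_eq {f : ℂ → ℂ} (hf : Differentiable ℂ f) {w : ℂ} (hw : f w ≠ 0)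
    {a b T : ℝ} (hab : a ≤ b) (hT : 0 ≤ T) {S : Finset ℂ}
    (hS : ∀ ρ, ρ ∈ S ↔ (a ≤ ρ.re ∧ ρ.re ≤ b ∧ 0 ≤ ρ.im ∧ ρ.im ≤ T) ∧ f ρ = 0) :
    hor (logDeriv f) a b 0 + ver (logDeriv f) b 0 T - hor (logDeriv f) a b T
      - ver (logDeriv f) a 0 T = ∑ ρ ∈ S, (analyticOrderNatAt f ρ : ℝ) * angle a b T ρ := by
  obtain ⟨g, hg, hfg, hgS⟩ := exists_zeroProd_factor hf hw S
  have hg0 : ∀ z : ℂ, a ≤ z.re → z.re ≤ b → 0 ≤ z.im → z.im ≤ T → g z ≠ 0 :=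
    fun z h1 h2 h3 h4 h0 => hgS z ((hS z).2 ⟨⟨h1, h2, h3, h4⟩, by rw [hfg z, h0, mul_zero]⟩) h0
  have hh : ∀ y, 0 ≤ y → y ≤ T → ∀ x ∈ Set.uIcc a b, g (x + y * Complex.I) ≠ 0 :=
    fun y h1 h2 x hx => by
      rw [Set.uIcc_of_le hab] at hx
      exact hg0 _ (by simpa using hx.1) (by simpa using hx.2) (by simpa) (by simpa)
  have hv : ∀ x, a ≤ x → x ≤ b → ∀ y ∈ Set.uIcc 0 T, g (x + y * Complex.I) ≠ 0 :=
    fun x h1 h2 y hy => by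
      rw [Set.uIcc_of_le hT] at hy
      exact hg0 _ (by simpa) (by simpa) (by simpa using hy.1) (by simpa using hy.2)
  have hzero := rect_eq_zero (F := logDeriv g) hab hT fun z h1 h2 h3 h4 =>
    (hg.deriv z).div (hg z) (hg0 z h1 h2 h3 h4)
  rw [hor_logDeriv_eq hg hfg (hh 0 le_rfl hT), hor_logDeriv_eq hg hfg (hh T hT le_rfl),
    ver_logDeriv_eq hg hfg (hv b hab le_rfl), ver_logDeriv_eq hg hfg (hv a le_rfl hab)]
  have hsum : ∀ A B C D p q r s : ℝ, p + q - r - s = 0 →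
      A + p + (B + q) - (C + r) - (D + s) = A + B - C - D := by intros; linarith
  -- The zero-free factor contributes nothing by Cauchy's theorem; only the arctangents of the zeros
  -- remain, regrouped by corners below.
  rw [hsum _ _ _ _ _ _ _ _ hzero, ← Finset.sum_add_distrib, ← Finset.sum_sub_distrib,
    ← Finset.sum_sub_distrib]
  refine Finset.sum_congr rfl fun ρ hρ => ?_
  obtain ⟨⟨h1, h2, h3, h4⟩, -⟩ := (hS ρ).1 hρ
  rw [← mul_add, ← mul_sub, ← mul_sub]
  congr 1
  rw [angle, ← arctan_div_add_arctan_div _ _ (by linarith) (by linarith),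
    ← arctan_div_add_arctan_div _ _ (by linarith) (by linarith),
    ← arctan_div_add_arctan_div _ _ (by linarith) (by linarith),
    ← arctan_div_add_arctan_div _ _ (by linarith) (by linarith)]
  have n1 : (b - ρ.re) / (ρ.im - T) = -((b - ρ.re) / (T - ρ.im)) := by
    rw [← neg_sub T, div_neg]
  have n2 : (a - ρ.re) / (ρ.im - T) = (ρ.re - a) / (T - ρ.im) := by
    rw [← neg_sub T, ← neg_sub ρ.re, neg_div_neg_eq]
  have n3 : (a - ρ.re) / ρ.im = -((ρ.re - a) / ρ.im) := by rw [← neg_sub, neg_div]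
  have n4 : (T - ρ.im) / (a - ρ.re) = -((T - ρ.im) / (ρ.re - a)) := by rw [← neg_sub ρ.re, div_neg]
  have n5 : -ρ.im / (a - ρ.re) = ρ.im / (ρ.re - a) := by rw [← neg_sub ρ.re, neg_div_neg_eq]
  simp only [sub_zero, zero_sub, n1, n2, n3, n4, n5, neg_div, Real.arctan_neg]
  ring

/-! ### The phase on the critical line: existence and uniqueness -/

lemma hasDerivAt_vertical {g : ℂ → ℂ} (hg : Differentiable ℂ g) (x y : ℝ) :
    HasDerivAt (fun y : ℝ => g (x + y * Complex.I)) (deriv g (x + y * Complex.I) * Complex.I) y := by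
  have h1 : HasDerivAt (fun y : ℝ => (x + y * Complex.I : ℂ)) Complex.I y := by
    have := (Complex.ofRealCLM.hasDerivAt (x := y)).mul_const Complex.I
    simpa using this.const_add (x : ℂ)
  exact (hg _).hasDerivAt.comp y h1

lemma ver_logDeriv_eq_log {g : ℂ → ℂ} (hg : Differentiable ℂ g) {x p q : ℝ} {c : ℂ}
    (h : ∀ y ∈ Set.uIcc p q, g (x + y * Complex.I) / c ∈ Complex.slitPlane) :
    ver (logDeriv g) x p q = (Complex.log (g (x + q * Complex.I) / c)).im
      - (Complex.log (g (x + p * Complex.I) / c)).im := by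
  have hne : ∀ y ∈ Set.uIcc p q, c ≠ 0 ∧ g (x + y * Complex.I) ≠ 0 := fun y hy => by
    have := Complex.slitPlane_ne_zero (h y hy)
    rw [div_ne_zero_iff] at this; exact this.symm
  refine intervalIntegral.integral_eq_sub_of_hasDerivAt
    (f := fun y : ℝ => (Complex.log (g (x + y * Complex.I) / c)).im) (fun y hy => ?_) ?_
  · have h1 := ((hasDerivAt_vertical hg x y).div_const c).clog_real (h y hy)
    have h2 := Complex.imCLM.hasFDerivAt.comp_hasDerivAt y h1
    refine h2.congr_deriv ?_
    have h3 : deriv g (x + y * Complex.I) * Complex.I / c / (g (x + y * Complex.I) / c)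
        = Complex.I * logDeriv g (x + y * Complex.I) := by
      have := (hne y hy).1; have := (hne y hy).2
      rw [logDeriv_apply]; field_simp
    rw [h3, Complex.imCLM_apply, Complex.I_mul_im]
  · refine ContinuousOn.intervalIntegrable fun y hy => ContinuousAt.continuousWithinAt ?_
    exact Complex.continuous_re.continuousAt.comp (ContinuousAt.comp
      (f := fun y : ℝ => (x + y * Complex.I : ℂ)) (continuousAt_logDeriv hg (hne y hy).2)
      (by fun_prop))

/-- Zeros on the segment cause no singularity: almost everywhere the real part equals a sum in which
their terms vanish, plus a continuous function. -/
lemma intervalIntegrable_re_logDeriv {f : ℂ → ℂ} (hf : Differentiable ℂ f) {w : ℂ} (hw : f w ≠ 0)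
    (x p q : ℝ) : IntervalIntegrable (fun y : ℝ => (logDeriv f (x + y * Complex.I)).re)
      MeasureTheory.volume p q := by
  have hK : IsCompact ((fun y : ℝ => (x + y * Complex.I : ℂ)) '' Set.uIcc p q) :=
    isCompact_uIcc.image (by fun_prop)
  have hfin := finite_zeros_of_isCompact hf hw hK
  obtain ⟨g, hg, hfg, hgS⟩ := exists_zeroProd_factor hf hw hfin.toFinset
  have hg0 : ∀ y ∈ Set.uIcc p q, g (x + y * Complex.I) ≠ 0 := fun y hy h0 =>
    hgS (x + y * Complex.I)
      (hfin.mem_toFinset.2 ⟨Set.mem_image_of_mem _ hy, by rw [hfg, h0, mul_zero]⟩) h0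
  have hi : ∀ ρ : ℂ, IntervalIntegrable (fun y : ℝ => ((x + y * Complex.I - ρ)⁻¹).re)
      MeasureTheory.volume p q := fun ρ => by
    simp only [re_inv_sub]; exact intervalIntegrable_div_sq_add_sq _ _ _ _
  have hgi : IntervalIntegrable (fun y : ℝ => (logDeriv g (x + y * Complex.I)).re)
      MeasureTheory.volume p q := by
    refine ContinuousOn.intervalIntegrable fun y hy => ContinuousAt.continuousWithinAt ?_
    exact Complex.continuous_re.continuousAt.comp (ContinuousAt.comp
      (f := fun y : ℝ => (x + y * Complex.I : ℂ)) (continuousAt_logDeriv hg (hg0 y hy))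
      (by fun_prop))
  have hs : IntervalIntegrable (fun y : ℝ => ∑ ρ ∈ hfin.toFinset, (analyticOrderNatAt f ρ : ℝ) *
      ((x + y * Complex.I - ρ)⁻¹).re) MeasureTheory.volume p q := by
    simpa only [Finset.sum_fn] using IntervalIntegrable.sum hfin.toFinset
      fun ρ _ => (hi ρ).const_mul _
  refine (hs.add hgi).congr_ae ?_
  rw [Filter.EventuallyEq, MeasureTheory.ae_restrict_iff' measurableSet_uIoc]
  filter_upwards [ae_ver_notMem hfin.toFinset x] with y hy hym
  rw [logDeriv_eq_sum_add hg hfg hy (hg0 y (Set.uIoc_subset_uIcc hym))]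
  simp only [Complex.add_re, Complex.re_sum, ← Complex.ofReal_natCast, Complex.re_ofReal_mul]

lemma ver_add {f : ℂ → ℂ} (hf : Differentiable ℂ f) {w : ℂ} (hw : f w ≠ 0) (x p q r : ℝ) :
    ver (logDeriv f) x p q + ver (logDeriv f) x q r = ver (logDeriv f) x p r :=
  intervalIntegral.integral_add_adjacent_intervals (intervalIntegrable_re_logDeriv hf hw x p q)
    (intervalIntegrable_re_logDeriv hf hw x q r)

lemma ae_ne_zero_vertical {f : ℂ → ℂ} (hf : Differentiable ℂ f) {w : ℂ} (hw : f w ≠ 0)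
    (x p q : ℝ) : ∀ᵐ y : ℝ, y ∈ Set.uIoc p q → f (x + y * Complex.I) ≠ 0 := by
  have hK : IsCompact ((fun y : ℝ => (x + y * Complex.I : ℂ)) '' Set.uIcc p q) :=
    isCompact_uIcc.image (by fun_prop)
  have hfin := finite_zeros_of_isCompact hf hw hK
  filter_upwards [ae_ver_notMem hfin.toFinset x] with y hy hym h0
  exact hy (hfin.mem_toFinset.2 ⟨Set.mem_image_of_mem _ (Set.uIoc_subset_uIcc hym), h0⟩)

lemma half_add (t : ℝ) : (1 / 2 + Complex.I * t : ℂ) = ((1 / 2 : ℝ) : ℂ) + t * Complex.I := by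
  push_cast; ring

/-- The phase is determined by the logarithmic derivative on the critical line. -/
lemma IsOmega.eq_sub_ver {ω : ℝ → ℝ} (h : IsOmega ω) (T : ℝ) :
    ω T = ω 0 - ver (logDeriv auxR) (1 / 2) 0 T := by
  obtain ⟨hω, -, g, hg, hR⟩ := h
  have hd : ∀ t, HasDerivAt ω (deriv ω t) t := fun t =>
    (hω t (Set.mem_univ t)).differentiableAt.hasDerivAt
  have hdc : Continuous (deriv ω) := continuous_iff_continuousAt.2 fun t =>
    (hω t (Set.mem_univ t)).deriv.continuousAt
  have h1 : ∫ t in (0 : ℝ)..T, deriv ω t = ω T - ω 0 :=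
    intervalIntegral.integral_eq_sub_of_hasDerivAt (fun t _ => hd t) (hdc.intervalIntegrable _ _)
  have h2 : ver (logDeriv auxR) (1 / 2) 0 T = ∫ t in (0 : ℝ)..T, -deriv ω t := by
    refine intervalIntegral.integral_congr_ae ?_
    filter_upwards [ae_ne_zero_vertical differentiable_auxR auxR_half_ne_zero (1 / 2) 0 T]
      with t ht htm
    have hne := ht htm
    have d1 := hasDerivAt_vertical differentiable_auxR (1 / 2) t
    have hgd := (hg t (Set.mem_univ t)).differentiableAt.hasDerivAt
    have d2 : HasDerivAt (fun t : ℝ => Complex.exp (-(Complex.I * (ω t : ℂ))) * (g t : ℂ))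
        (Complex.exp (-(Complex.I * (ω t : ℂ))) * (-(Complex.I * ((deriv ω t : ℝ) : ℂ))) * (g t : ℂ)
          + Complex.exp (-(Complex.I * (ω t : ℂ))) * ((deriv g t : ℝ) : ℂ)) t := by
      have d3 : HasDerivAt (fun t : ℝ => (ω t : ℂ)) ((deriv ω t : ℝ) : ℂ) t := (hd t).ofReal_comp
      have d4 : HasDerivAt (fun t : ℝ => (g t : ℂ)) ((deriv g t : ℝ) : ℂ) t := hgd.ofReal_comp
      have d5 : HasDerivAt (fun t : ℝ => -(Complex.I * (ω t : ℂ)))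
        (-(Complex.I * ((deriv ω t : ℝ) : ℂ))) t := (d3.const_mul Complex.I).fun_neg
      exact d5.cexp.fun_mul d4
    have hfun : (fun t : ℝ => auxR (((1 / 2 : ℝ) : ℂ) + t * Complex.I))
        = fun t : ℝ => Complex.exp (-(Complex.I * (ω t : ℂ))) * (g t : ℂ) := by
      funext t; rw [← half_add, hR t]
    rw [hfun] at d1
    have e1 := d1.unique d2
    have e2 : auxR (((1 / 2 : ℝ) : ℂ) + t * Complex.I)
        = Complex.exp (-(Complex.I * (ω t : ℂ))) * (g t : ℂ) := congrFun hfun t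
    have hg0 : (g t : ℂ) ≠ 0 := fun h0 => hne (by rw [e2, h0, mul_zero])
    have he := Complex.exp_ne_zero (-(Complex.I * (ω t : ℂ)))
    -- Along the vertical line differentiation brings in a factor $i$, so $i\mathcal R'/\mathcal
    -- R=-i\omega'+g'/g$.
    have e3 : logDeriv auxR (((1 / 2 : ℝ) : ℂ) + t * Complex.I)
        = -((deriv ω t : ℝ) : ℂ) - Complex.I * ((deriv g t / g t : ℝ) : ℂ) := by
      have : deriv auxR (((1 / 2 : ℝ) : ℂ) + t * Complex.I) =
        (-((deriv ω t : ℝ) : ℂ) - Complex.I * ((deriv g t / g t : ℝ) : ℂ)) *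
          (Complex.exp (-(Complex.I * (ω t : ℂ))) * (g t : ℂ)) := by
        refine mul_right_cancel₀ Complex.I_ne_zero (e1.trans ?_)
        push_cast
        field_simp
        linear_combination ((deriv g t : ℝ) : ℂ) * Complex.I_sq
      rw [logDeriv_apply, this, e2, mul_div_cancel_right₀ _ (mul_ne_zero he hg0)]
    rw [e3]
    simp
  rw [intervalIntegral.integral_neg, h1] at h2
  rw [h2]; ring

/-- The phase, defined by integrating the logarithmic derivative. -/
noncomputable def phase (t : ℝ) : ℝ :=
  -Complex.arg (auxR (1 / 2)) - ver (logDeriv auxR) (1 / 2) 0 t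

lemma eventually_ver_eq_log {g : ℂ → ℂ} (hg : Differentiable ℂ g) {x a : ℝ}
    (h0 : g (x + a * Complex.I) ≠ 0) : ∀ᶠ t : ℝ in nhds a,
      (∀ y ∈ Set.uIcc a t, g (x + y * Complex.I) ≠ 0) ∧ ver (logDeriv g) x a t =
      (Complex.log (g (x + t * Complex.I) / g (x + a * Complex.I))).im := by
  have hc : ContinuousAt (fun t : ℝ => g (x + t * Complex.I) / g (x + a * Complex.I)) a := by
    have := hg.continuous
    fun_prop
  have hs : ∀ᶠ t : ℝ in nhds a,
      g (x + t * Complex.I) / g (x + a * Complex.I) ∈ Complex.slitPlane :=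
    hc.eventually_mem (Complex.isOpen_slitPlane.mem_nhds (by
      rw [div_self h0]; exact Complex.one_mem_slitPlane))
  obtain ⟨ε, hε, hball⟩ := Metric.eventually_nhds_iff_ball.1 hs
  filter_upwards [Metric.ball_mem_nhds a hε] with t ht
  have hsub : Set.uIcc a t ⊆ Metric.ball a ε := by
    rw [← segment_eq_uIcc]
    exact (convex_ball a ε).segment_subset (Metric.mem_ball_self hε) ht
  have hsl := fun y (hy : y ∈ Set.uIcc a t) => hball y (hsub hy)
  refine ⟨fun y hy h => Complex.slitPlane_ne_zero (hsl y hy) (by rw [h, zero_div]), ?_⟩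
  rw [ver_logDeriv_eq_log hg hsl, div_self h0]
  simp

/-- The possible zero at $\tfrac12+ia$ is divided out; its factor contributes nothing to the
vertical integral, so the phase continues analytically through it. -/
lemma phase_eventually_eq {g : ℂ → ℂ} (hg : Differentiable ℂ g) {a : ℝ}
    (h0 : g (((1 / 2 : ℝ) : ℂ) + a * Complex.I) ≠ 0)
    (hfg : ∀ z, auxR z = zeroProd auxR {((1 / 2 : ℝ) : ℂ) + a * Complex.I} z * g z) :
    ∀ᶠ t : ℝ in nhds a, phase t = phase a - (Complex.log
      (g (((1 / 2 : ℝ) : ℂ) + t * Complex.I) / g (((1 / 2 : ℝ) : ℂ) + a * Complex.I))).im := by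
  filter_upwards [eventually_ver_eq_log hg h0] with t ht
  have h1 := ver_add differentiable_auxR auxR_half_ne_zero (1 / 2) 0 a t
  have h2 := ver_logDeriv_eq hg hfg ht.1
  rw [Finset.sum_singleton] at h2
  simp only [Complex.add_re, Complex.ofReal_re, Complex.mul_re, Complex.I_re, mul_zero,
    Complex.ofReal_im, Complex.I_im, mul_one, sub_self, add_zero, div_zero, Real.arctan_zero,
    zero_add] at h2
  rw [← ht.2, ← h2, phase, phase, ← h1]
  ring

lemma analyticAt_vertical {g : ℂ → ℂ} (hg : Differentiable ℂ g) (x a : ℝ) :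
    AnalyticAt ℝ (fun t : ℝ => g (x + t * Complex.I)) a := by
  have h1 : AnalyticAt ℝ g (x + a * Complex.I) := (hg.analyticAt _).restrictScalars
  have h2 : AnalyticAt ℝ (fun t : ℝ => (x + t * Complex.I : ℂ)) a :=
    analyticAt_const.add ((Complex.ofRealCLM.analyticAt a).mul analyticAt_const)
  exact h1.comp (f := fun t : ℝ => (x + t * Complex.I : ℂ)) h2

lemma analyticAt_phase (a : ℝ) : AnalyticAt ℝ phase a := by
  obtain ⟨g, hg, hfg, hgS⟩ := exists_zeroProd_factor differentiable_auxR auxR_half_ne_zero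
    {((1 / 2 : ℝ) : ℂ) + a * Complex.I}
  have h0 := hgS _ (Finset.mem_singleton_self _)
  have h1 := phase_eventually_eq hg h0 hfg
  refine AnalyticAt.congr ?_ (h1.mono fun t ht => ht.symm)
  refine analyticAt_const.sub ?_
  have h2 : AnalyticAt ℝ (fun t : ℝ => g (((1 / 2 : ℝ) : ℂ) + t * Complex.I) /
      g (((1 / 2 : ℝ) : ℂ) + a * Complex.I)) a := by
    simp only [div_eq_mul_inv]
    exact (analyticAt_vertical hg (1 / 2) a).mul analyticAt_const
  have h3 : AnalyticAt ℝ Complex.log (g (((1 / 2 : ℝ) : ℂ) + a * Complex.I) /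
      g (((1 / 2 : ℝ) : ℂ) + a * Complex.I)) := by
    rw [div_self h0]
    exact (analyticAt_clog Complex.one_mem_slitPlane).restrictScalars
  exact (Complex.imCLM.analyticAt _).comp (h3.comp (f := fun t : ℝ =>
    g (((1 / 2 : ℝ) : ℂ) + t * Complex.I) / g (((1 / 2 : ℝ) : ℂ) + a * Complex.I)) h2)

lemma phase_zero : phase 0 = -Complex.arg (auxR (1 / 2)) := by simp [phase, ver]

lemma isOmega_phase : IsOmega phase := by
  refine ⟨fun t _ => analyticAt_phase t, phase_zero, ?_⟩
  set k : ℝ → ℂ := fun t => Complex.exp (Complex.I * (phase t : ℂ)) *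
    auxR (((1 / 2 : ℝ) : ℂ) + t * Complex.I) with hk
  have hka : ∀ t, AnalyticAt ℝ k t := fun t => by
    have h1 : AnalyticAt ℝ (fun t => (phase t : ℂ)) t :=
      (Complex.ofRealCLM.analyticAt _).comp (analyticAt_phase t)
    have h2 : AnalyticAt ℝ Complex.exp (Complex.I * (phase t : ℂ)) :=
      (Complex.differentiable_exp.analyticAt _).restrictScalars
    exact (h2.comp (f := fun t : ℝ => Complex.I * (phase t : ℂ)) (analyticAt_const.mul h1)).mul
      (analyticAt_vertical differentiable_auxR (1 / 2) t)
  have hre : AnalyticOnNhd ℝ (fun t => (k t).re) Set.univ := fun t _ =>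
    (Complex.reCLM.analyticAt _).comp (hka t)
  have him : AnalyticOnNhd ℝ (fun t => (k t).im) Set.univ := fun t _ =>
    (Complex.imCLM.analyticAt _).comp (hka t)
  have hR0 : auxR (((1 / 2 : ℝ) : ℂ) + (0 : ℝ) * Complex.I) = auxR (1 / 2) := by norm_num
  -- Near $t=0$ there is no zero, and $e^{i\,\mathtt{phase}}\mathcal R$ is an explicit positive real
  -- number. The identity theorem extends the vanishing of its imaginary part to the whole line,
  -- across the zeros.
  have hlocal : (fun t => (k t).im) =ᶠ[nhds 0] fun _ => 0 := by
    have hzp : ∀ z, auxR z = zeroProd auxR {((1 / 2 : ℝ) : ℂ) + (0 : ℝ) * Complex.I} z * auxR z := by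
      intro z
      have : analyticOrderNatAt auxR (((1 / 2 : ℝ) : ℂ) + (0 : ℝ) * Complex.I) = 0 := by
        by_contra h
        exact auxR_half_ne_zero (hR0 ▸ apply_eq_zero_of_analyticOrderNatAt_ne_zero h)
      rw [zeroProd, Finset.prod_singleton, this, pow_zero, one_mul]
    have h0 : auxR (((1 / 2 : ℝ) : ℂ) + (0 : ℝ) * Complex.I) ≠ 0 := by
      rw [hR0]; exact auxR_half_ne_zero
    filter_upwards [phase_eventually_eq differentiable_auxR h0 hzp,
      eventually_ver_eq_log differentiable_auxR h0] with t ht ht2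
    rw [hR0, phase_zero] at ht
    have hRt := ht2.1 t Set.right_mem_uIcc
    set L := Complex.log (auxR (((1 / 2 : ℝ) : ℂ) + t * Complex.I) / auxR (1 / 2)) with hL
    have hexp : auxR (((1 / 2 : ℝ) : ℂ) + t * Complex.I) = Complex.exp L * auxR (1 / 2) := by
      rw [hL, Complex.exp_log (div_ne_zero hRt auxR_half_ne_zero),
        div_mul_cancel₀ _ auxR_half_ne_zero]
    have hkt : k t = ((Real.exp L.re * ‖auxR (1 / 2)‖ : ℝ) : ℂ) := by
      simp only [hk]
      rw [hexp, ht]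
      nth_rewrite 2 [← Complex.norm_mul_exp_arg_mul_I (auxR (1 / 2))]
      rw [show ∀ a b c d : ℂ, a * (b * (c * d)) = a * b * d * c by intros; ring,
        ← Complex.exp_add, ← Complex.exp_add, Complex.ofReal_mul, Complex.ofReal_exp]
      congr 2
      nth_rewrite 2 [← Complex.re_add_im L]
      push_cast
      ring
    rw [hkt, Complex.ofReal_im]
  have hzero := him.eq_of_eventuallyEq (analyticOnNhd_const (v := (0 : ℝ))) hlocal
  refine ⟨fun t => (k t).re, hre, fun t => ?_⟩
  have h1 : ((k t).re : ℂ) = k t := by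
    have := congrFun hzero t
    exact Complex.ext (by simp) (by simpa using this.symm)
  rw [h1, half_add]
  simp only [hk]
  rw [← mul_assoc, ← Complex.exp_add]
  simp

lemma existsUnique_isOmega : ∃! ω : ℝ → ℝ, IsOmega ω :=
  ⟨phase, isOmega_phase, fun ω h => funext fun t => by
    rw [h.eq_sub_ver t, h.2.1, phase]⟩

/-! ### Counting zeros and estimating the edges -/

lemma mem_slitPlane_of_norm_sub_one_le {z : ℂ} (h : ‖z - 1‖ ≤ 1 / 2) : z ∈ Complex.slitPlane := by
  rw [Complex.mem_slitPlane_iff]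
  left
  have := (abs_le.1 ((Complex.abs_re_le_norm (z - 1)).trans h)).1
  rw [Complex.sub_re, Complex.one_re] at this
  linarith

lemma finite_zeros_rect (b T : ℝ) :
    {ρ : ℂ | (1 / 2 ≤ ρ.re ∧ ρ.re ≤ b ∧ 0 ≤ ρ.im ∧ ρ.im ≤ T) ∧ auxR ρ = 0}.Finite := by
  refine (finite_zeros_of_isCompact differentiable_auxR auxR_half_ne_zero
    (isCompact_Icc (a := (1 / 2 : ℝ)) (b := b) |>.reProdIm (isCompact_Icc (a := 0) (b := T)))).subset ?_
  rintro ρ ⟨⟨h1, h2, h3, h4⟩, h0⟩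
  exact ⟨Complex.mem_reProdIm.2 ⟨⟨h1, h2⟩, h3, h4⟩, h0⟩

/-- The zeros of `auxR` in the closed rectangle `[1/2, b] × [0, T]`. -/
noncomputable def rectZeros (b T : ℝ) : Finset ℂ := (finite_zeros_rect b T).toFinset

lemma mem_rectZeros {b T : ℝ} {ρ : ℂ} : ρ ∈ rectZeros b T ↔
    (1 / 2 ≤ ρ.re ∧ ρ.re ≤ b ∧ 0 ≤ ρ.im ∧ ρ.im ≤ T) ∧ auxR ρ = 0 := by
  rw [rectZeros, Set.Finite.mem_toFinset, Set.mem_ofPred_eq]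

lemma re_lt_of_zero {b : ℝ} (hb : ∀ s : ℂ, b ≤ s.re → 0 ≤ s.im → ‖auxR s - 1‖ ≤ 1 / 2) {ρ : ℂ}
    (h0 : auxR ρ = 0) (him : 0 ≤ ρ.im) : ρ.re < b := by
  by_contra! h
  have := hb ρ h him
  rw [h0] at this
  norm_num at this

lemma rightZeros_eq {b : ℝ} (hb : ∀ s : ℂ, b ≤ s.re → 0 ≤ s.im → ‖auxR s - 1‖ ≤ 1 / 2) (T : ℝ) :
    rightZeros T = ((rectZeros b T).filter fun ρ => 0 < ρ.im : Finset ℂ) := by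
  ext ρ
  rw [Finset.mem_coe, Finset.mem_filter, mem_rectZeros, rightZeros, Set.mem_ofPred_eq]
  constructor
  · rintro ⟨h0, h1, h2, h3⟩
    exact ⟨⟨⟨h3, (re_lt_of_zero hb h0 h1.le).le, h1.le, h2⟩, h0⟩, h1⟩
  · rintro ⟨⟨⟨h3, -, -, h2⟩, h0⟩, h1⟩
    exact ⟨h0, h1, h2, h3⟩

lemma rightZeros_finite (T : ℝ) : (rightZeros T).Finite := by
  obtain ⟨b, -, hb⟩ := exists_norm_auxR_sub_one_le
  rw [rightZeros_eq hb]
  exact Finset.finite_toSet _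

/-- The excluded corner is the one genuine discrepancy: a zero there sees the angle $\pi/2$ but has
weight $\tfrac12$, which corresponds to $\pi$. -/
lemma angle_eq_weight {b T : ℝ} {ρ : ℂ} (h1 : 1 / 2 ≤ ρ.re) (h2 : ρ.re < b) (h3 : 0 < ρ.im)
    (h4 : ρ.im ≤ T) (hc : ρ ≠ 1 / 2 + T * Complex.I) :
    angle (1 / 2) b T ρ = 2 * Real.pi * weight T ρ := by
  have hne : ρ.re ≠ 1 / 2 ∨ ρ.im ≠ T := by
    by_contra! h
    exact hc (Complex.ext (by simpa using h.1) (by simpa using h.2))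
  rw [angle, weight]
  rcases h1.eq_or_lt with e1 | e1
  · have e2 : ρ.im < T := h4.lt_of_ne (hne.resolve_left fun h => h e1.symm)
    rw [if_neg (by rintro ⟨h, -⟩; linarith), if_neg (by rintro ⟨h, -⟩; linarith),
      if_pos ⟨by linarith, h3⟩, if_pos ⟨by linarith, by linarith⟩, if_pos (Or.inl e1.symm)]
    ring
  · rcases h4.eq_or_lt with e2 | e2
    · rw [if_pos ⟨by linarith, h3⟩, if_neg (by rintro ⟨-, h⟩; linarith),
        if_pos ⟨by linarith, h3⟩, if_neg (by rintro ⟨-, h⟩; linarith), if_pos (Or.inr e2)]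
      ring
    · rw [if_pos ⟨by linarith, h3⟩, if_pos ⟨by linarith, by linarith⟩, if_pos ⟨by linarith, h3⟩,
        if_pos ⟨by linarith, by linarith⟩, if_neg (by rintro (h | h) <;> linarith)]
      ring

lemma angle_mem_Icc (a b T : ℝ) (ρ : ℂ) : 0 ≤ angle a b T ρ ∧ angle a b T ρ ≤ 2 * Real.pi := by
  have := Real.pi_pos
  unfold angle
  constructor <;> split_ifs <;> linarith

lemma weight_mem_Icc (T : ℝ) (ρ : ℂ) : 0 ≤ weight T ρ ∧ weight T ρ ≤ 1 := by
  unfold weight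
  constructor <;> split_ifs <;> norm_num

/-- Comparison of the angle-weighted count of the zeros in a rectangle with `2π Nr`. -/
lemma abs_sum_angle_sub_Nr_le {b T : ℝ}
    (hb : ∀ s : ℂ, b ≤ s.re → 0 ≤ s.im → ‖auxR s - 1‖ ≤ 1 / 2) :
    |∑ ρ ∈ rectZeros b T, (analyticOrderNatAt auxR ρ : ℝ) * angle (1 / 2) b T ρ
      - 2 * Real.pi * Nr T| ≤
      2 * Real.pi * ∑ ρ ∈ rectZeros b 0, (analyticOrderNatAt auxR ρ : ℝ)
        + 2 * Real.pi * (analyticOrderNatAt auxR (1 / 2 + T * Complex.I) : ℝ) := by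
  classical
  have hp := Real.pi_pos
  have hN : Nr T = ∑ ρ ∈ rectZeros b T,
      if 0 < ρ.im then weight T ρ * (analyticOrderNatAt auxR ρ : ℝ) else 0 := by
    rw [Nr, rightZeros_eq hb, finsum_mem_coe_finset, Finset.sum_filter]
  rw [hN, Finset.mul_sum, ← Finset.sum_sub_distrib]
  have hterm : ∀ ρ ∈ rectZeros b T, |(analyticOrderNatAt auxR ρ : ℝ) * angle (1 / 2) b T ρ
      - 2 * Real.pi * (if 0 < ρ.im then weight T ρ * (analyticOrderNatAt auxR ρ : ℝ) else 0)| ≤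
      (if ρ.im = 0 then 2 * Real.pi * (analyticOrderNatAt auxR ρ : ℝ) else 0) +
      (if ρ = 1 / 2 + T * Complex.I then
        2 * Real.pi * (analyticOrderNatAt auxR (1 / 2 + T * Complex.I) : ℝ) else 0) := by
    intro ρ hρ
    obtain ⟨⟨h1, -, h3, h4⟩, h0⟩ := mem_rectZeros.1 hρ
    have h2 := re_lt_of_zero hb h0 h3
    have hm : (0 : ℝ) ≤ (analyticOrderNatAt auxR ρ : ℝ) := Nat.cast_nonneg _
    obtain ⟨a1, a2⟩ := angle_mem_Icc (1 / 2) b T ρ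
    obtain ⟨w1, w2⟩ := weight_mem_Icc T ρ
    -- Zeros on the real axis carry an angle but are not counted in $N_r$; their total is bounded
    -- independently of $T$.
    rcases h3.eq_or_lt with e | e
    · rw [if_neg (by linarith), if_pos e.symm, mul_zero, sub_zero, abs_of_nonneg (by positivity)]
      have : 0 ≤ (if ρ = 1 / 2 + T * Complex.I then
        2 * Real.pi * (analyticOrderNatAt auxR (1 / 2 + T * Complex.I) : ℝ) else 0) := by
        split_ifs <;> positivity
      nlinarith
    · rw [if_pos e, if_neg e.ne', zero_add]
      by_cases hc : ρ = 1 / 2 + T * Complex.I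
      · rw [if_pos hc, ← hc]
        have e1 : (analyticOrderNatAt auxR ρ : ℝ) * angle (1 / 2) b T ρ
          - 2 * Real.pi * (weight T ρ * (analyticOrderNatAt auxR ρ : ℝ))
          = (analyticOrderNatAt auxR ρ : ℝ) * (angle (1 / 2) b T ρ - 2 * Real.pi * weight T ρ) := by
          ring
        rw [e1, abs_mul, abs_of_nonneg hm, mul_comm (2 * Real.pi) (analyticOrderNatAt auxR ρ : ℝ)]
        refine mul_le_mul_of_nonneg_left (abs_le.2 ⟨?_, ?_⟩) hm <;> nlinarith
      · rw [if_neg hc, angle_eq_weight h1 h2 e h4 hc]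
        exact le_of_eq (abs_eq_zero.2 (by ring))
  refine (Finset.abs_sum_le_sum_abs _ _).trans ((Finset.sum_le_sum hterm).trans ?_)
  rw [Finset.sum_add_distrib, ← Finset.sum_filter, ← Finset.mul_sum]
  refine add_le_add (mul_le_mul_of_nonneg_left ?_ (by positivity)) ?_
  · refine Finset.sum_le_sum_of_subset_of_nonneg (fun ρ hρ => ?_) fun _ _ _ => Nat.cast_nonneg _
    obtain ⟨hρ1, hρ2⟩ := Finset.mem_filter.1 hρ
    obtain ⟨⟨h1, h2, h3, h4⟩, h0⟩ := mem_rectZeros.1 hρ1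
    exact mem_rectZeros.2 ⟨⟨h1, h2, h3, hρ2.le⟩, h0⟩
  · rw [Finset.sum_ite_eq']
    split_ifs
    · exact le_rfl
    · positivity

/-- The variation of the argument along the upper edge, and the multiplicity of the corner, are
`O(log T)`. -/
lemma exists_top_bound {b : ℝ} (hb2 : 2 ≤ b)
    (hb : ∀ s : ℂ, b ≤ s.re → 0 ≤ s.im → ‖auxR s - 1‖ ≤ 1 / 2) :
    ∃ C : ℝ, ∀ᶠ T : ℝ in atTop, |hor (logDeriv auxR) (1 / 2) b T| ≤ C * Real.log T ∧
      (analyticOrderNatAt auxR (1 / 2 + T * Complex.I) : ℝ) ≤ C * Real.log T := by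
  -- The local decomposition is used with $r=2b$ about $b+iT$: radius $r/2=b$ covers the upper edge,
  -- and radius $3r=6b$ reaches left to real part $-5b$. Taking $T\ge6b$ keeps this disc in the
  -- closed upper half-plane.
  set A : ℝ := 5 * b with hA
  obtain ⟨C, hC0, hC⟩ := exists_norm_auxR_le (A := A) (by positivity)
  have hl2 : 0 < Real.log 2 := Real.log_pos one_lt_two
  have hp := Real.pi_pos
  refine ⟨(A + 2) / Real.log 2 * Real.pi + 12 * (A + 2) + (A + 2) / Real.log 2, ?_⟩
  filter_upwards [eventually_ge_atTop (6 * b), eventually_ge_atTop (2 * C * 3 ^ (A + 1))]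
    with T hT1 hT2
  have hT0 : 1 < T := by linarith
  set c : ℂ := b + T * Complex.I with hc
  have hcre : c.re = b := by simp [hc]
  have hcim : c.im = T := by simp [hc]
  have hfc : 1 / 2 ≤ ‖auxR c‖ := by
    have h1 := hb c hcre.ge (by rw [hcim]; linarith)
    have h2 := norm_sub_norm_le (1 : ℂ) (auxR c)
    rw [norm_sub_rev, norm_one] at h2
    have := h2.trans h1
    linarith
  have hM : 1 < T ^ (A + 2) := Real.one_lt_rpow hT0 (by positivity)
  have hfM : ∀ z, ‖z - c‖ ≤ 3 * (2 * b) → ‖auxR z‖ ≤ T ^ (A + 2) * ‖auxR c‖ := by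
    intro z hz
    have h1 := abs_le.1 ((Complex.abs_re_le_norm (z - c)).trans hz)
    have h2 := abs_le.1 ((Complex.abs_im_le_norm (z - c)).trans hz)
    rw [Complex.sub_re, hcre] at h1
    rw [Complex.sub_im, hcim] at h2
    have h3 := hC z (by linarith) (by linarith)
    have h4 : (z.im + 3) ^ (A + 1) ≤ (3 * T) ^ (A + 1) :=
      Real.rpow_le_rpow (by linarith) (by linarith) (by positivity)
    rw [Real.mul_rpow (by norm_num) (by linarith)] at h4
    have h5 : T ^ (A + 2) = T * T ^ (A + 1) := by
      rw [← Real.rpow_one_add' (by linarith) (by positivity)]; congr 1; ring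
    have h6 : 0 < T ^ (A + 1) := Real.rpow_pos_of_pos (by linarith) _
    calc ‖auxR z‖ ≤ C * (3 ^ (A + 1) * T ^ (A + 1)) :=
          h3.trans (mul_le_mul_of_nonneg_left h4 hC0.le)
      _ = (2 * C * 3 ^ (A + 1)) * T ^ (A + 1) * (1 / 2) := by ring
      _ ≤ T * T ^ (A + 1) * ‖auxR c‖ := by gcongr
      _ = T ^ (A + 2) * ‖auxR c‖ := by rw [h5]
  obtain ⟨S, g, hS, hcount, hg, hfg, hg0, hgl⟩ := exists_local_decomposition differentiable_auxR
    (c := c) (fun h => by rw [h, norm_zero] at hfc; norm_num at hfc)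
    (by positivity : 0 < 2 * b) hM hfM
  rw [Real.log_rpow (by linarith)] at hcount hgl
  have hL : 0 < Real.log T := Real.log_pos hT0
  set N := ∑ ρ ∈ S, analyticOrderNatAt auxR ρ with hN
  have hNle : (N : ℝ) ≤ (A + 2) / Real.log 2 * Real.log T := by
    rw [div_mul_eq_mul_div, le_div_iff₀ hl2]; exact hcount
  have hdist : ∀ x : ℝ, 1 / 2 ≤ x → x ≤ b → ‖(x + T * Complex.I : ℂ) - c‖ ≤ b := fun x h1 h2 => by
    have : (x + T * Complex.I : ℂ) - c = ((x - b : ℝ) : ℂ) := by simp [hc]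
    rw [this, Complex.norm_real, Real.norm_eq_abs, abs_le]
    constructor <;> linarith
  have hq : 0 ≤ (A + 2) / Real.log 2 * Real.log T := by positivity
  have hA2 : 0 ≤ 12 * (A + 2) * Real.log T := by positivity
  constructor
  · rw [hor_logDeriv_eq hg hfg fun x hx => by
      rw [Set.uIcc_of_le (by linarith)] at hx
      exact hg0 _ ((hdist x hx.1 hx.2).trans (by linarith))]
    -- Each zero changes the argument by at most $\pi$ along a segment, wherever it lies.
    have h1 : |∑ ρ ∈ S, (analyticOrderNatAt auxR ρ : ℝ) *
        (Real.arctan ((b - ρ.re) / (ρ.im - T)) - Real.arctan ((1 / 2 - ρ.re) / (ρ.im - T)))|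
        ≤ N * Real.pi := by
      refine (Finset.abs_sum_le_sum_abs _ _).trans ?_
      rw [hN, Nat.cast_sum, Finset.sum_mul]
      refine Finset.sum_le_sum fun ρ _ => ?_
      rw [abs_mul, Nat.abs_cast]
      refine mul_le_mul_of_nonneg_left ?_ (Nat.cast_nonneg _)
      have u1 := Real.arctan_lt_pi_div_two ((b - ρ.re) / (ρ.im - T))
      have u2 := Real.neg_pi_div_two_lt_arctan ((b - ρ.re) / (ρ.im - T))
      have u3 := Real.arctan_lt_pi_div_two ((1 / 2 - ρ.re) / (ρ.im - T))
      have u4 := Real.neg_pi_div_two_lt_arctan ((1 / 2 - ρ.re) / (ρ.im - T))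
      rw [abs_le]; constructor <;> linarith
    have h2 : |hor (logDeriv g) (1 / 2) b T| ≤ 12 * (A + 2) * Real.log T := by
      have h3 := intervalIntegral.norm_integral_le_of_norm_le_const (a := 1 / 2) (b := b)
        (f := fun x : ℝ => (logDeriv g (x + T * Complex.I)).im)
        (C := 24 / (2 * b) * ((A + 2) * Real.log T)) (fun x hx => by
          rw [Set.uIoc_of_le (by linarith)] at hx
          rw [Real.norm_eq_abs]
          refine (Complex.abs_im_le_norm _).trans (hgl _ ?_)
          exact (hdist x hx.1.le hx.2).trans (by linarith))
      rw [Real.norm_eq_abs] at h3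
      refine h3.trans ?_
      rw [abs_of_nonneg (by linarith)]
      have e : 24 / (2 * b) * ((A + 2) * Real.log T) * (b - 1 / 2)
        = 12 * (A + 2) * Real.log T * ((b - 1 / 2) / b) := by field_simp; ring
      rw [e]
      refine mul_le_of_le_one_right hA2 ?_
      rw [div_le_one (by linarith)]; linarith
    refine (abs_add_le _ _).trans ?_
    have h4 := mul_le_mul_of_nonneg_right hNle hp.le
    linarith
  · have h1 : (analyticOrderNatAt auxR (1 / 2 + T * Complex.I) : ℝ) ≤ N := by
      by_cases h0 : auxR (1 / 2 + T * Complex.I) = 0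
      · have hmem : (1 / 2 + T * Complex.I : ℂ) ∈ S := by
          rw [hS]
          refine ⟨?_, h0⟩
          have := hdist (1 / 2) le_rfl (by linarith)
          push_cast at this
          linarith
        rw [hN]
        exact_mod_cast Finset.single_le_sum (f := fun ρ => analyticOrderNatAt auxR ρ)
          (fun _ _ => Nat.zero_le _) hmem
      · have : analyticOrderNatAt auxR (1 / 2 + T * Complex.I) = 0 := by
          by_contra h
          exact h0 (apply_eq_zero_of_analyticOrderNatAt_ne_zero h)
        rw [this, Nat.cast_zero]; exact Nat.cast_nonneg _
    have h2 : 0 ≤ (A + 2) / Real.log 2 * Real.log T * Real.pi := by positivity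
    linarith

/-- On the right edge the values stay in the slit plane, so a single branch of the logarithm serves
the whole edge. -/
lemma abs_ver_right_le {b T : ℝ} (hb : ∀ s : ℂ, b ≤ s.re → 0 ≤ s.im → ‖auxR s - 1‖ ≤ 1 / 2)
    (hT : 0 ≤ T) : |ver (logDeriv auxR) b 0 T| ≤ 2 * Real.pi := by
  rw [ver_logDeriv_eq_log differentiable_auxR (c := 1) fun y hy => by
    rw [Set.uIcc_of_le hT] at hy
    rw [div_one]
    exact mem_slitPlane_of_norm_sub_one_le (hb _ (by simp) (by simpa using hy.1))]
  rw [Complex.log_im, Complex.log_im]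
  have h1 := Complex.abs_arg_le_pi (auxR (b + T * Complex.I) / 1)
  have h2 := Complex.abs_arg_le_pi (auxR (b + (0 : ℝ) * Complex.I) / 1)
  exact (abs_sub _ _).trans (by linarith)

theorem isBigO_omega_sub_Nr {ω : ℝ → ℝ} (hω : IsOmega ω) :
    (fun T : ℝ => ω T - 2 * Real.pi * Nr T) =O[atTop] (fun T : ℝ => Real.log T) := by
  obtain ⟨b, hb2, hb⟩ := exists_norm_auxR_sub_one_le
  obtain ⟨C, hC⟩ := exists_top_bound hb2 hb
  set K := |ω 0| + |hor (logDeriv auxR) (1 / 2) b 0| + 2 * Real.pi +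
    2 * Real.pi * ∑ ρ ∈ rectZeros b 0, (analyticOrderNatAt auxR ρ : ℝ) with hK
  have hp := Real.pi_pos
  have hK0 : 0 ≤ K := by positivity
  refine IsBigO.of_bound (K + C + 2 * Real.pi * C) ?_
  filter_upwards [hC, eventually_ge_atTop (Real.exp 1)] with T ⟨h1, h2⟩ hT
  have hT0 : 0 < T := (Real.exp_pos 1).trans_le hT
  have hL : 1 ≤ Real.log T := (Real.le_log_iff_exp_le hT0).2 hT
  -- The left edge of this identity is $\omega(0)-\omega(T)$; all other terms are bounded or $O(\log
  -- T)$.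
  have h3 := rect_logDeriv_eq differentiable_auxR auxR_half_ne_zero (a := 1 / 2) (b := b)
    (by linarith) hT0.le (fun ρ => mem_rectZeros)
  have h4 := abs_sum_angle_sub_Nr_le hb (T := T)
  have h5 := abs_ver_right_le hb hT0.le
  rw [← h3] at h4
  have h6 := hω.eq_sub_ver T
  rw [Real.norm_eq_abs, Real.norm_of_nonneg (by linarith)]
  have h7 : K ≤ K * Real.log T := le_mul_of_one_le_right hK0 hL
  have h8 := mul_le_mul_of_nonneg_left h2 (by positivity : 0 ≤ 2 * Real.pi)
  have b1 := abs_le.1 h1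
  have b4 := abs_le.1 h4
  have b5 := abs_le.1 h5
  have b6 := neg_abs_le (ω 0)
  have b7 := le_abs_self (ω 0)
  have b8 := neg_abs_le (hor (logDeriv auxR) (1 / 2) b 0)
  have b9 := le_abs_self (hor (logDeriv auxR) (1 / 2) b 0)
  rw [abs_le]
  constructor <;> linarith [b1.1, b1.2, b4.1, b4.2, b5.1, b5.2]

end RiemannAuxiliary

theorem mainTheorem2 :
    Differentiable ℂ RiemannAuxiliary.auxR ∧
    (∀ T : ℝ, (RiemannAuxiliary.rightZeros T).Finite) ∧
    (∃! ω : ℝ → ℝ, RiemannAuxiliary.IsOmega ω) ∧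
    ∀ ω : ℝ → ℝ, RiemannAuxiliary.IsOmega ω →
      (fun T : ℝ => ω T - 2 * Real.pi * RiemannAuxiliary.Nr T) =O[atTop]
        (fun T : ℝ => Real.log T) :=
  ⟨RiemannAuxiliary.differentiable_auxR, RiemannAuxiliary.rightZeros_finite,
    RiemannAuxiliary.existsUnique_isOmega, fun _ h => RiemannAuxiliary.isBigO_omega_sub_Nr h⟩
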